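/- We work in the deterministic $\mathsf{LOCAL}$ model: the network is a finite simple graph $G=(V,E)$ on $n$ nodes; in each synchronous round every node sends a message of unbounded size (possibly different ones) to each neighbour, receives the messages of its neighbours, and performs arbitrary internal computation. All nodes run the same algorithm and know $n$ and an upper bound $\Delta$ on the maximum degree of $G$; nodes have distinct identifiers in $\mathbb{N}$ and access their incident edges through an arbitrary port numbering. For an edge $e$ let $\deg(e)$ be the number of edges $e'\ne e$ that share an endpoint with $e$. For $\bar\Delta,C\in\mathbb{N}$ and a real $S$, let $P(\bar\Delta,S,C)$ be the family of list edge coloring instances consisting of a graph $G$ with $\max_e \deg(e)=\bar\Delta$ (the maximum being $0$ if there are no edges) and lists $L_e\subseteq\{1,\dots,C\}$ with $|L_e|>S\cdot\deg(e)$ for every edge $e$ (slack at least $S$). All nodes know $C$, and both endpoints of $e$ initially know $L_e$. To solve the instance, both endpoints of every edge $e$ must output a common color $c_e\in L_e$ such that $c_e\neq c_{e'}$ whenever $e\neq e'$ share an endpoint. **Statement.** If the nodes are provided with a proper $2$-vertex coloring of $G$ (each node initially knows its own color) and $S\ge e^2$, with $e$ here being Euler's number, then $P(\bar\Delta,S,C)$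 can be solved in $O(\log^7 C\cdot\log^4\Delta)$ rounds. That is, there are an absolute constant $K$ and deterministic $\mathsf{LOCAL}$ algorithms, depending only on $n,\Delta,C$, such that for all $n$, $\Delta$, $C$, $\bar\Delta$ and all $S\ge e^2$, every instance of $P(\bar\Delta,S,C)$ with a given $2$-vertex coloring on an $n$-node graph of maximum degree at most $\Delta$ is solved within at most $K\cdot(\log_2 C)^7\cdot(\log_2\Delta)^4$ rounds, for all identifiers and port numberings (where $\log_2 0$ is read as $0$). -/

import Mathlib

/-! ### The deterministic LOCAL model -/

namespace LocalModel

/-- A deterministic LOCAL algorithm. A node of degree `d` starts with a local input in `In d`,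
and its incident edges are accessed through the ports `0, …, d - 1`. In every round a node sends
one message through each port (possibly different ones, of unrestricted size), receives one message
through each port, and updates its state by an arbitrary function (unrestricted internal
computation). At the end it produces a local output in `Out d`. All nodes run the same algorithm. -/
structure Algorithm (In Out : ℕ → Type) where
  State : ℕ → Type
  Msg : Type
  init : (d : ℕ) → In d → State d
  send : (d : ℕ) → State d → Fin d → Msg
  receive : (d : ℕ) → State d → (Fin d → Msg) → State d
  output : (d : ℕ) → State d → Out d

/-- A port numbering: each node `v` numbers its incident edges (equivalently, its neighbours)
by `0, …, deg v - 1` in an arbitrary way. -/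
abbrev PortNumbering {V : Type} [Fintype V] (G : SimpleGraph V) [DecidableRel G.Adj] : Type :=
  (v : V) → Fin (G.degree v) ≃ G.neighborSet v

/-- The port of `u` that leads to its neighbour `v`. -/
def PortNumbering.portTo {V : Type} [Fintype V] {G : SimpleGraph V} [DecidableRel G.Adj]
    (port : PortNumbering G) {u v : V} (h : G.Adj u v) : Fin (G.degree u) :=
  (port u).symm ⟨v, h⟩

/-- The states of all nodes after `t` synchronous rounds. In each round the message that `v`
receives through port `i` is the one that the neighbour `u` behind that port has sent through
its own port leading to `v`. -/
def Algorithm.run {In Out : ℕ → Type} (A : Algorithm In Out)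
    {V : Type} [Fintype V] (G : SimpleGraph V) [DecidableRel G.Adj]
    (port : PortNumbering G) (input : (v : V) → In (G.degree v)) :
    ℕ → (v : V) → A.State (G.degree v)
  | 0, v => A.init _ (input v)
  | t + 1, v => A.receive _ (A.run G port input t v) fun i =>
      A.send _ (A.run G port input t (port v i).1)
        (port.portTo (G.adj_symm (port v i).2))

/-- The outputs of all nodes if the algorithm is stopped after `t` rounds. -/
def Algorithm.result {In Out : ℕ → Type} (A : Algorithm In Out)
    {V : Type} [Fintype V] (G : SimpleGraph V) [DecidableRel G.Adj]
    (port : PortNumbering G) (input : (v : V) → In (G.degree v)) (t : ℕ) (v : V) :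
    Out (G.degree v) :=
  A.output _ (A.run G port input t v)

end LocalModel

/-! ### List edge coloring -/

namespace ListEdgeColoring

open LocalModel

/-- The degree of an edge, i.e. its degree in the line graph. -/
noncomputable def edgeDegree {V : Type} (G : SimpleGraph V) (e : G.edgeSet) : ℕ :=
  (G.lineGraph.neighborSet e).ncard

/-- The maximum edge degree (`0` if there are no edges). -/
noncomputable def maxEdgeDegree {V : Type} [Fintype V] [DecidableEq V] (G : SimpleGraph V)
    [DecidableRel G.Adj] : ℕ :=
  Finset.univ.sup (edgeDegree G)

/-- Slack at least `S`: every list is larger than `S` times the degree of its edge. -/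
def HasSlack {V : Type} (G : SimpleGraph V) (L : G.edgeSet → Finset ℕ) (S : ℝ) : Prop :=
  ∀ e : G.edgeSet, S * (edgeDegree G e : ℝ) < ((L e).card : ℝ)

/-- The list edge coloring instance `(G, L)` belongs to the family `P(Δbar, S, C)`: maximum edge
degree `Δbar`, slack at least `S`, and all lists taken from the color space `{1, …, C}`. -/
structure InFamily {V : Type} [Fintype V] [DecidableEq V] (G : SimpleGraph V) [DecidableRel G.Adj]
    (L : G.edgeSet → Finset ℕ) (Δbar : ℕ) (S : ℝ) (C : ℕ) : Prop where
  maxEdgeDegree_eq : maxEdgeDegree G = Δbar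
  slack : HasSlack G L S
  lists_subset : ∀ e : G.edgeSet, L e ⊆ Finset.Icc 1 C

/-- What a node of degree `d` knows locally at the start: its unique identifier, its color in the
given 2-vertex coloring, and the color lists of its incident edges, indexed by the ports. -/
structure NodeInput (d : ℕ) where
  ident : ℕ
  side : Bool
  list : Fin d → Finset ℕ

/-- A node of degree `d` outputs a color for each of its incident edges. -/
abbrev NodeOutput (d : ℕ) : Type := Fin d → ℕ

/-- The edge of `G` behind port `i` of node `v`. -/
def portEdge {V : Type} [Fintype V] {G : SimpleGraph V} [DecidableRel G.Adj]
    (port : PortNumbering G) (v : V) (i : Fin (G.degree v)) : G.edgeSet :=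
  ⟨s(v, (port v i).1), G.mem_edgeSet.mpr (port v i).2⟩

/-- The initial local inputs of the nodes. -/
def nodeInput {V : Type} [Fintype V] {G : SimpleGraph V} [DecidableRel G.Adj]
    (port : PortNumbering G) (ident : V → ℕ) (side : G.Coloring Bool)
    (L : G.edgeSet → Finset ℕ) (v : V) : NodeInput (G.degree v) where
  ident := ident v
  side := side v
  list := fun i => L (portEdge port v i)

/-- The node outputs form a solution of the list edge coloring instance `(G, L)`: there is a proper
edge coloring with colors from the lists such that both endpoints of every edge output its color. -/
def IsSolution {V : Type} [Fintype V] {G : SimpleGraph V} [DecidableRel G.Adj]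
    (port : PortNumbering G) (L : G.edgeSet → Finset ℕ)
    (out : (v : V) → NodeOutput (G.degree v)) : Prop :=
  ∃ col : G.lineGraph.Coloring ℕ,
    (∀ e : G.edgeSet, col e ∈ L e) ∧ ∀ v i, out v i = col (portEdge port v i)

end ListEdgeColoring

/-! Write ℓ for roughly log C and J for roughly log Δ, so that colors are below 2^ℓ and degrees at
most 2^J. Level i splits every subproblem by the i-th bit of the color: each edge commits to one
value of the bit and keeps only the matching colors. Edges with different commitments have disjoint
lists and no longer interact. The commitments must keep the degree of every edge proportional to its
remaining list, however unevenly the list splits.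

Choosing the bits is an orientation problem. Orienting an edge towards its `true` end means bit one;
its degree in the new subproblem is then bounded by a difference of two loads (numbers of edges
oriented towards its ends) plus a quantity known in advance. An orientation whose load differences
respect `levelTarget` up to a relative error 1/(4ℓ) costs a factor 1 + 1/(2ℓ) of slack
(`nodeDeg_nextLevel`), so starting from slack 2 the slack stays at least 1 on all ℓ levels
(`one_le_slackAt`).

The orientation is built by inserting edges in bulk and rebalancing. Each inserted edge puts a
token, a unit of surplus load, on its preferred end, and tokens travel along overloaded edges by
flipping them. After the token game, settled tokens are nearly level along every overloaded edge not
flipped (`TokenGame.passive_src_le`). The insertion rates decrease geometrically, and an edge joins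
only when the rate is small against the error it tolerates. Hence all edges of large weight get
oriented (`Balancing.final_ne_none`) with small error (`Balancing.excess_final_le`).

The error is affordable only for lists above a polylogarithmic threshold. Edges with shorter lists
are left out at their level, and after ℓ levels no edge remains (`level_alive_eq_empty`). The
left-out edges have small degree in their subproblem and are colored greedily, from the last level
back to the first (`GoodColoring.step`).

The whole procedure is a function of a set of labelled edges. Arbitrary choices depend only on sets
that the edges concerned can see, so all nodes make them consistently. `IsLocal` bounds the distance
on which a value depends; `gather` turns a radius into a number of rounds (`gather_result`), and the
radius is of order ℓ^7 J^3 (`localityRadius_le`). -/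

namespace DistributedColoring

open LocalModel ListEdgeColoring
open scoped Classical

/-! ### Instances as sets of labelled edges, and functions of bounded locality -/

/-- An edge of a bipartite graph labelled by the identifiers of its endpoints and its color list. -/
structure LEdge where
  left : ℕ
  right : ℕ
  colors : Finset ℕ

def Adjacent (e f : LEdge) : Prop := f.left = e.left ∨ f.right = e.right

/-- The edges of `E` that share an endpoint with `e` (including `e` itself if `e ∈ E`). -/
noncomputable def nbhd (E : Finset LEdge) (e : LEdge) : Finset LEdge := E.filter (Adjacent e)

/-- The instances `E` and `E'` look the same from `e` up to distance `t`. -/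
def Agree (E E' : Finset LEdge) : ℕ → LEdge → Prop
  | 0, _ => True
  | t + 1, e => nbhd E e = nbhd E' e ∧ ∀ f ∈ nbhd E e, Agree E E' t f

theorem Agree.pred {E E' : Finset LEdge} : ∀ {t : ℕ} {e : LEdge},
    Agree E E' (t + 1) e → Agree E E' t e
  | 0, _, _ => trivial
  | _ + 1, _, h => ⟨h.1, fun f hf => Agree.pred (h.2 f hf)⟩

theorem Agree.mono {E E' : Finset LEdge} {s t : ℕ} (hst : s ≤ t) {e : LEdge}
    (h : Agree E E' t e) : Agree E E' s e := by
  induction t, hst using Nat.le_induction with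
  | base => exact h
  | succ t _ ih => exact ih h.pred

/-- The value of `f` at an edge depends only on the edges up to distance `t`. -/
def IsLocal {X : Type*} (t : ℕ) (f : Finset LEdge → LEdge → X) : Prop :=
  ∀ E E' e, Agree E E' t e → f E e = f E' e

namespace IsLocal

variable {X Y Z : Type*} {s t : ℕ}

theorem mono {f : Finset LEdge → LEdge → X} (hf : IsLocal s f) (hst : s ≤ t) : IsLocal t f :=
  fun E E' e h => hf E E' e (h.mono hst)

theorem congr {f g : Finset LEdge → LEdge → X} (hf : IsLocal t f) (h : ∀ E e, f E e = g E e) :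
    IsLocal t g := fun E E' e a => by rw [← h, ← h, hf E E' e a]

theorem static (f : LEdge → X) : IsLocal t fun _ e => f e := fun _ _ _ _ => rfl

theorem map {f : Finset LEdge → LEdge → X} (hf : IsLocal t f) (h : X → Y) :
    IsLocal t fun E e => h (f E e) := fun E E' e a => congrArg h (hf E E' e a)

theorem map₂ {f : Finset LEdge → LEdge → X} {g : Finset LEdge → LEdge → Y} (hf : IsLocal t f)
    (hg : IsLocal t g) (h : X → Y → Z) : IsLocal t fun E e => h (f E e) (g E e) :=
  fun E E' e a => by simp only [hf E E' e a, hg E E' e a]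

theorem prod {f : Finset LEdge → LEdge → X} {g : Finset LEdge → LEdge → Y} (hf : IsLocal t f)
    (hg : IsLocal t g) : IsLocal t fun E e => (f E e, g E e) := hf.map₂ hg Prod.mk

/-- The unit of communication: one more unit of distance gives access to the values of `f` on all
adjacent edges. The radius bounds below count uses of this lemma. -/
theorem step {f : Finset LEdge → LEdge → X} {g : Finset LEdge → LEdge → Y} (hf : IsLocal t f)
    (h : ∀ E E' e, nbhd E e = nbhd E' e → (∀ a ∈ nbhd E e, f E a = f E' a) → f E e = f E' e →
      g E e = g E' e) : IsLocal (t + 1) g :=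
  fun E E' e a => h E E' e a.1 (fun b hb => hf E E' b (a.2 b hb)) (hf E E' e a.pred)

/-- Radius 0 carries no information about the instance, so even membership of the edge itself costs
one unit. -/
theorem mem : IsLocal 1 fun E e => e ∈ E := by
  refine step (t := 0) (static fun _ => ()) fun E E' e h _ _ => ?_
  have key : ∀ F : Finset LEdge, e ∈ F ↔ e ∈ nbhd F e := fun F => by simp [nbhd, Adjacent]
  exact propext ((key E).trans (h ▸ (key E').symm))

end IsLocal

/-! ### Gathering neighborhoods in the LOCAL model -/

/-- The labelled edge of a node on side `b` with identifier `x`, to a node with identifier `y`. -/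
def mkEdge (b : Bool) (x y : ℕ) (l : Finset ℕ) : LEdge := if b then ⟨x, y, l⟩ else ⟨y, x, l⟩

/-- All nodes repeatedly exchange everything they know, and then evaluate `F` on the subgraph
known to them. -/
noncomputable def gather (F : Finset LEdge → LEdge → ℕ) : Algorithm NodeInput NodeOutput where
  State d := NodeInput d × (Fin d → ℕ) × Finset LEdge
  Msg := ℕ × Finset LEdge
  init _ x := (x, fun _ => 0, ∅)
  send _ s _ := (s.1.ident, s.2.2)
  receive _ s m := (s.1, fun i => (m i).1,
    s.2.2 ∪ (Finset.univ.biUnion fun i => (m i).2) ∪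
      Finset.univ.image fun i => mkEdge s.1.side s.1.ident (m i).1 (s.1.list i))
  output _ s i := F s.2.2 (mkEdge s.1.side s.1.ident (s.2.1 i) (s.1.list i))

section Simulation

variable {V : Type} [Fintype V] {G : SimpleGraph V} [DecidableRel G.Adj]

/-- The labelled edge behind a port. -/
def portLabel (port : PortNumbering G) (ident : V → ℕ) (side : G.Coloring Bool)
    (L : G.edgeSet → Finset ℕ) (v : V) (i : Fin (G.degree v)) : LEdge :=
  mkEdge (side v) (ident v) (ident (port v i).1) (L (portEdge port v i))

/-- The set of all labelled edges. -/
noncomputable def allEdges (port : PortNumbering G) (ident : V → ℕ) (side : G.Coloring Bool)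
    (L : G.edgeSet → Finset ℕ) : Finset LEdge :=
  Finset.univ.biUnion fun v => Finset.univ.image (portLabel port ident side L v)

variable (port : PortNumbering G) (ident : V → ℕ) (side : G.Coloring Bool)
    (L : G.edgeSet → Finset ℕ) (F : Finset LEdge → LEdge → ℕ)

theorem gather_run_input (t : ℕ) (v : V) :
    ((gather F).run G port (nodeInput port ident side L) t v).1
      = nodeInput port ident side L v := by
  induction t with
  | zero => rfl
  | succ t ih => exact ih

theorem gather_run_ident (t : ℕ) (v : V) (i : Fin (G.degree v)) :
    ((gather F).run G port (nodeInput port ident side L) (t + 1) v).2.1 i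
      = ident (port v i).1 := by
  change ((gather F).run G port (nodeInput port ident side L) t (port v i).1).1.ident = _
  rw [gather_run_input]
  rfl

/-- The edges known to a node after `t` rounds. -/
noncomputable def known (t : ℕ) (v : V) : Finset LEdge :=
  ((gather F).run G port (nodeInput port ident side L) t v).2.2

theorem known_succ (t : ℕ) (v : V) :
    known port ident side L F (t + 1) v = known port ident side L F t v ∪
      (Finset.univ.biUnion fun i => known port ident side L F t (port v i).1) ∪
      Finset.univ.image (portLabel port ident side L v) := by
  have h : known port ident side L F (t + 1) v = known port ident side L F t v ∪
      (Finset.univ.biUnion fun i => known port ident side L F t (port v i).1) ∪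
      Finset.univ.image fun i =>
        mkEdge ((gather F).run G port (nodeInput port ident side L) t v).1.side
          ((gather F).run G port (nodeInput port ident side L) t v).1.ident
          (((gather F).run G port (nodeInput port ident side L) (t + 1) v).2.1 i)
          (((gather F).run G port (nodeInput port ident side L) t v).1.list i) := rfl
  rw [h]
  simp only [gather_run_ident, gather_run_input]
  rfl

theorem known_subset (t : ℕ) (v : V) :
    known port ident side L F t v ⊆ allEdges port ident side L := by
  induction t generalizing v with
  | zero => exact Finset.empty_subset _
  | succ t ih =>
    rw [known_succ]
    refine Finset.union_subset (Finset.union_subset (ih v) ?_) ?_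
    · exact Finset.biUnion_subset.2 fun i _ => ih _
    · intro e he
      exact Finset.mem_biUnion.2 ⟨v, Finset.mem_univ _, he⟩

theorem portLabel_mem_known (t : ℕ) (v : V) (i : Fin (G.degree v)) :
    portLabel port ident side L v i ∈ known port ident side L F (t + 1) v := by
  rw [known_succ]
  exact Finset.mem_union_right _ (Finset.mem_image_of_mem _ (Finset.mem_univ _))

omit [Fintype V] [DecidableRel G.Adj] in
theorem mkEdge_sides {v w : V} (h : G.Adj v w) (l : Finset ℕ) :
    mkEdge (side v) (ident v) (ident w) l = mkEdge (side w) (ident w) (ident v) l := by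
  have := side.valid h
  unfold mkEdge
  cases h1 : side v <;> cases h2 : side w <;> simp_all

/-- An edge meeting the edge behind port `i` of `v` is incident to `v` or to the neighbor there, so
its label occurs as a port label of one of these two nodes. -/
theorem exists_port_of_share (hid : Function.Injective ident) (v : V) (i : Fin (G.degree v))
    {f : LEdge} (hf : f ∈ allEdges port ident side L)
    (h : f.left = (portLabel port ident side L v i).left ∨
      f.right = (portLabel port ident side L v i).right) :
    (∃ j, f = portLabel port ident side L v j) ∨
      ∃ j, f = portLabel port ident side L (port v i).1 j := by
  obtain ⟨x, -, hx⟩ := Finset.mem_biUnion.1 hf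
  obtain ⟨j, -, rfl⟩ := Finset.mem_image.1 hx
  have h1 := side.valid (port x j).2
  have h2 := side.valid (port v i).2
  have key : ∀ a b : V, a = b → ∀ k, (∃ j, portLabel port ident side L a k =
      portLabel port ident side L b j) := by rintro a _ rfl k; exact ⟨k, rfl⟩
  -- The same edge seen from its other endpoint has the same label.
  have back : ∃ k, portLabel port ident side L x j = portLabel port ident side L (port x j).1 k := by
    refine ⟨port.portTo (G.adj_symm (port x j).2), ?_⟩
    have hp : (port (port x j).1 (port.portTo (G.adj_symm (port x j).2))).1 = x := by
      simp [PortNumbering.portTo]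
    unfold portLabel
    rw [mkEdge_sides ident side (port x j).2, hp]
    congr 2
    unfold portEdge
    simp only [hp, Sym2.eq_swap]
  have main : x = v ∨ x = (port v i).1 ∨ (port x j).1 = v ∨ (port x j).1 = (port v i).1 := by
    simp only [portLabel, mkEdge] at h
    cases hs1 : side x <;> cases hs2 : side v <;> simp only [hs1, hs2] at h <;>
      simp at h <;> rcases h with h | h <;> have := hid h <;> tauto
  rcases main with h | h | h | h
  · exact Or.inl (key _ _ h j)
  · exact Or.inr (key _ _ h j)
  · obtain ⟨k, hk⟩ := back
    exact Or.inl (hk ▸ key _ _ h k)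
  · obtain ⟨k, hk⟩ := back
    exact Or.inr (hk ▸ key _ _ h k)

/-- Stated for every `K` between the known edges and all edges: in the induction the radius drops
while `K` stays fixed, and `K` contains what `v` and its neighbor knew one round before. -/
theorem agree_known (hid : Function.Injective ident) (t : ℕ) (v : V) (i : Fin (G.degree v))
    (K : Finset LEdge) (h1 : known port ident side L F (t + 1) v ⊆ K)
    (h2 : K ⊆ allEdges port ident side L) :
    Agree K (allEdges port ident side L) t (portLabel port ident side L v i) := by
  induction t generalizing v i with
  | zero => trivial
  | succ t ih =>
    have hv : known port ident side L F (t + 1) v ⊆ K := fun e he => h1 (by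
      rw [known_succ]; exact Finset.mem_union_left _ (Finset.mem_union_left _ he))
    have hu : known port ident side L F (t + 1) (port v i).1 ⊆ K := fun e he => h1 (by
      rw [known_succ]
      exact Finset.mem_union_left _ (Finset.mem_union_right _
        (Finset.mem_biUnion.2 ⟨i, Finset.mem_univ _, he⟩)))
    have hshare := fun f : LEdge => exists_port_of_share (f := f) port ident side L hid v i
    refine ⟨?_, ?_⟩
    · ext f
      simp only [nbhd, Finset.mem_filter]
      refine ⟨fun h => ⟨h2 h.1, h.2⟩, fun h => ⟨?_, h.2⟩⟩
      rcases hshare f h.1 h.2 with ⟨j, rfl⟩ | ⟨j, rfl⟩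
      · exact hv (portLabel_mem_known ..)
      · exact hu (portLabel_mem_known ..)
    · intro f hf
      obtain ⟨hf1, hf2⟩ := Finset.mem_filter.1 hf
      rcases hshare f (h2 hf1) hf2 with ⟨j, rfl⟩ | ⟨j, rfl⟩
      · exact ih v j hv
      · exact ih _ j hu

/-- The round beyond the radius is needed because a node learns the identifiers of its neighbors,
hence the labels of its own edges, only in the first round. -/
theorem gather_result (hid : Function.Injective ident) {t : ℕ} (hF : IsLocal t F) (v : V)
    (i : Fin (G.degree v)) :
    (gather F).result G port (nodeInput port ident side L) (t + 1) v i
      = F (allEdges port ident side L) (portLabel port ident side L v i) := by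
  have h : (gather F).result G port (nodeInput port ident side L) (t + 1) v i
      = F (known port ident side L F (t + 1) v)
        (mkEdge ((gather F).run G port (nodeInput port ident side L) (t + 1) v).1.side
          ((gather F).run G port (nodeInput port ident side L) (t + 1) v).1.ident
          (((gather F).run G port (nodeInput port ident side L) (t + 1) v).2.1 i)
          (((gather F).run G port (nodeInput port ident side L) (t + 1) v).1.list i)) := rfl
  rw [h]
  simp only [gather_run_ident, gather_run_input]
  exact hF _ _ _ (agree_known port ident side L F hid t v i _ subset_rfl (known_subset ..))

end Simulation

end DistributedColoring

namespace DistributedColoring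

open scoped Classical

/-! ### The token dropping game -/

/-- A subset of `S` with `min k (card S)` elements. -/
noncomputable def take {ε : Type*} (S : Finset ε) (k : ℕ) : Finset ε :=
  (Finset.exists_subset_card_eq (min_le_right k S.card)).choose

theorem take_subset {ε : Type*} (S : Finset ε) (k : ℕ) : take S k ⊆ S :=
  (Finset.exists_subset_card_eq (min_le_right k S.card)).choose_spec.1

theorem card_take {ε : Type*} (S : Finset ε) (k : ℕ) : (take S k).card = min k S.card :=
  (Finset.exists_subset_card_eq (min_le_right k S.card)).choose_spec.2

/-- An element passed over proves that the quota was exhausted. The counting arguments for refused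
offers and rejected proposals rest on this. -/
theorem card_take_of_notMem {ε : Type*} {S : Finset ε} {k : ℕ} {e : ε} (he : e ∈ S)
    (h : e ∉ take S k) : (take S k).card = k := by
  rw [card_take, min_eq_left_iff]
  by_contra hk
  have : take S k = S := Finset.eq_of_subset_of_card_le (take_subset S k) (by
    rw [card_take]; omega)
  exact h (by rw [this]; exact he)

/-- A token dropping game: tokens move along arcs, every arc is used at most once. In a phase, a
node passes on at most `cap` tokens, receives at most `cap` tokens, and settles `rate` tokens. -/
structure TokenGame (ε N : Type) where
  arcs : Finset ε
  src : ε → N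
  dst : ε → N
  cap : N → ℕ
  rate : ℕ
  tokens : N → ℕ

/-- The used arcs, and for every node the numbers of active and of settled (passive) tokens. -/
structure TokenState (ε N : Type) where
  used : Finset ε
  active : N → ℕ
  passive : N → ℕ

namespace TokenGame

variable {ε N : Type} (g : TokenGame ε N) (s : TokenState ε N)

/-- The threshold guarantees enough tokens to settle `rate` of them and still pass on `cap`. -/
def Busy (v : N) : Prop := g.cap v + g.rate ≤ s.active v

/-- The arcs through which `v` could pass on a token. -/
noncomputable def candidates (v : N) : Finset ε :=
  g.arcs.filter fun e => e ∉ s.used ∧ g.src e = v ∧ ¬ g.Busy s (g.dst e)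

noncomputable def offers : Finset ε :=
  g.arcs.filter fun e => g.Busy s (g.src e) ∧ e ∈ take (g.candidates s (g.src e)) (g.cap (g.src e))

noncomputable def accepted : Finset ε :=
  g.arcs.filter fun e => e ∈ g.offers s ∧
    e ∈ take ((g.offers s).filter fun f => g.dst f = g.dst e) (g.cap (g.dst e))

noncomputable def next : TokenState ε N where
  used := s.used ∪ g.accepted s
  active v := if g.Busy s v then s.active v - g.rate - ((g.accepted s).filter (g.src · = v)).card
    else s.active v + ((g.accepted s).filter (g.dst · = v)).card
  passive v := if g.Busy s v then s.passive v + g.rate else s.passive v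

/-- The state after `t` phases. -/
noncomputable def run : ℕ → TokenState ε N
  | 0 => ⟨∅, g.tokens, fun _ => 0⟩
  | t + 1 => g.next (run t)

theorem offers_filter_src {v : N} (hv : g.Busy s v) :
    (g.offers s).filter (g.src · = v) = take (g.candidates s v) (g.cap v) := by
  ext e
  simp only [offers, Finset.mem_filter]
  constructor
  · rintro ⟨⟨_, _, h⟩, rfl⟩; exact h
  · intro h
    obtain ⟨h1, h2, rfl, h4⟩ := Finset.mem_filter.1 (take_subset _ _ h)
    exact ⟨⟨h1, hv, h⟩, rfl⟩

theorem accepted_filter_dst (v : N) :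
    (g.accepted s).filter (g.dst · = v) =
      take ((g.offers s).filter fun f => g.dst f = v) (g.cap v) := by
  ext e
  simp only [accepted, Finset.mem_filter]
  constructor
  · rintro ⟨⟨_, _, h⟩, rfl⟩; exact h
  · intro h
    obtain ⟨h1, rfl⟩ := Finset.mem_filter.1 (take_subset _ _ h)
    exact ⟨⟨(Finset.mem_filter.1 h1).1, h1, h⟩, rfl⟩

theorem accepted_subset_offers : g.accepted s ⊆ g.offers s :=
  fun _ he => (Finset.mem_filter.1 he).2.1

theorem mem_offers {e : ε} (he : e ∈ g.offers s) :
    e ∈ g.arcs ∧ e ∉ s.used ∧ g.Busy s (g.src e) ∧ ¬ g.Busy s (g.dst e) := by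
  obtain ⟨h1, h2, h3⟩ := Finset.mem_filter.1 he
  obtain ⟨-, h4, -, h5⟩ := Finset.mem_filter.1 (take_subset _ _ h3)
  exact ⟨h1, h4, h2, h5⟩

theorem card_accepted_dst_le (v : N) : ((g.accepted s).filter (g.dst · = v)).card ≤ g.cap v := by
  rw [accepted_filter_dst, card_take]; exact min_le_left _ _

theorem card_accepted_src_le (v : N) : ((g.accepted s).filter (g.src · = v)).card ≤ g.cap v := by
  by_cases hv : g.Busy s v
  · calc _ ≤ ((g.offers s).filter (g.src · = v)).card :=
        Finset.card_le_card (Finset.filter_subset_filter _ (g.accepted_subset_offers s))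
      _ ≤ g.cap v := by rw [offers_filter_src _ _ hv, card_take]; exact min_le_left _ _
  · rw [Finset.filter_false_of_mem]
    · exact Nat.zero_le _
    · rintro e he rfl
      exact hv (g.mem_offers s (g.accepted_subset_offers s he)).2.2.1

theorem accepted_filter_src_of_not_busy {v : N} (hv : ¬ g.Busy s v) :
    (g.accepted s).filter (g.src · = v) = ∅ := by
  refine Finset.filter_false_of_mem ?_
  rintro e he rfl
  exact hv (g.mem_offers s (g.accepted_subset_offers s he)).2.2.1

theorem accepted_filter_dst_of_busy {v : N} (hv : g.Busy s v) :
    (g.accepted s).filter (g.dst · = v) = ∅ := by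
  refine Finset.filter_false_of_mem ?_
  rintro e he rfl
  exact (g.mem_offers s (g.accepted_subset_offers s he)).2.2.2 hv

theorem disjoint_used_accepted : Disjoint s.used (g.accepted s) :=
  Finset.disjoint_right.2 fun _ he => (g.mem_offers s (g.accepted_subset_offers s he)).2.1

theorem used_subset_arcs (t : ℕ) : (g.run t).used ⊆ g.arcs := by
  induction t with
  | zero => exact Finset.empty_subset _
  | succ t ih => exact Finset.union_subset ih (Finset.filter_subset _ _)

theorem card_next_used_filter (p : ε → Prop) :
    ((g.next s).used.filter p).card = (s.used.filter p).card + ((g.accepted s).filter p).card := by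
  change ((s.used ∪ g.accepted s).filter p).card = _
  rw [Finset.filter_union, Finset.card_union_of_disjoint]
  exact Finset.disjoint_filter_filter (g.disjoint_used_accepted s)

theorem card_used_filter (p : ε → Prop) (t : ℕ) :
    ((g.run t).used.filter p).card =
      ∑ i ∈ Finset.range t, ((g.accepted (g.run i)).filter p).card := by
  induction t with
  | zero => rfl
  | succ t ih => rw [Finset.sum_range_succ, ← ih]; exact g.card_next_used_filter _ p

theorem conservation (t : ℕ) (v : N) :
    (g.run t).active v + (g.run t).passive v + ((g.run t).used.filter (g.src · = v)).card =
      g.tokens v + ((g.run t).used.filter (g.dst · = v)).card := by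
  induction t with
  | zero => simp [run]
  | succ t ih =>
    set s := g.run t with hs
    have h1 := g.card_next_used_filter s (g.src · = v)
    have h2 := g.card_next_used_filter s (g.dst · = v)
    change (g.next s).active v + (g.next s).passive v + _ = _ + _
    change ((g.run (t + 1)).used.filter _).card = _ at h1
    change ((g.run (t + 1)).used.filter _).card = _ at h2
    rw [h1, h2]
    by_cases hv : g.Busy s v
    · have h3 := g.card_accepted_src_le s v
      -- Being busy makes the truncated subtractions in `next` exact.
      have h4 : g.cap v + g.rate ≤ s.active v := hv
      simp only [next, if_pos hv, g.accepted_filter_dst_of_busy s hv, Finset.card_empty]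
      omega
    · simp only [next, if_neg hv, g.accepted_filter_src_of_not_busy s hv, Finset.card_empty]
      omega

theorem passive_eq (t : ℕ) (v : N) :
    (g.run t).passive v = g.rate * ((Finset.range t).filter fun i => g.Busy (g.run i) v).card := by
  induction t with
  | zero => rfl
  | succ t ih =>
    rw [Finset.range_add_one, Finset.filter_insert]
    change (g.next (g.run t)).passive v = _
    by_cases hv : g.Busy (g.run t) v
    · rw [if_pos hv, Finset.card_insert_of_notMem (by simp), mul_add, mul_one, ← ih]
      simp [next, hv]
    · rw [if_neg hv, ← ih]
      simp [next, hv]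

theorem passive_le (t : ℕ) (v : N) : (g.run t).passive v ≤ t * g.rate := by
  rw [passive_eq, mul_comm]
  exact Nat.mul_le_mul_right _ ((Finset.card_filter_le _ _).trans (by simp))

/-- A busy node loses at least `rate` active tokens per phase. A node that is not busy has fewer
than `cap + rate` of them and gains at most `cap`. -/
theorem active_le_max {k : ℕ} (v : N) (hk : g.tokens v ≤ k) (t : ℕ) :
    (g.run t).active v ≤ max (k - t * g.rate) (2 * g.cap v + g.rate) := by
  induction t with
  | zero => simpa [run] using Or.inl hk
  | succ t ih =>
    change (g.next (g.run t)).active v ≤ _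
    have h1 := g.card_accepted_dst_le (g.run t) v
    rw [add_mul, one_mul]
    by_cases hv : g.Busy (g.run t) v
    · have : (g.next (g.run t)).active v ≤ (g.run t).active v - g.rate := by
        simp only [next, if_pos hv]; omega
      omega
    · have : (g.next (g.run t)).active v ≤ (g.run t).active v + g.cap v := by
        simp only [next, if_neg hv]; omega
      have h2 : ¬ (g.cap v + g.rate ≤ (g.run t).active v) := hv
      omega

theorem active_le {T : ℕ} (v : N) (hT : g.tokens v ≤ T * g.rate) :
    (g.run T).active v ≤ 2 * g.cap v + g.rate := by
  simpa using g.active_le_max v hT T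

theorem used_mono {s t : ℕ} (h : s ≤ t) : (g.run s).used ⊆ (g.run t).used := by
  induction t, h using Nat.le_induction with
  | base => exact subset_rfl
  | succ t _ ih => exact ih.trans Finset.subset_union_left

variable {d : N → ℕ} {m : ℕ}

/-- Whenever `e` is refused, its target accepts a full quota of `cap` other tokens. Arcs are used at
most once, so the in-degree, at most `m * cap`, bounds `cap` times the number of refusals. -/
theorem card_refused_le (hcap : ∀ v, 0 < g.cap v) (hd : ∀ v, d v ≤ m * g.cap v)
    (hin : ∀ v, (g.arcs.filter (g.dst · = v)).card ≤ d v) (T : ℕ) (e : ε) :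
    ((Finset.range T).filter fun i => e ∈ g.offers (g.run i) ∧ e ∉ g.accepted (g.run i)).card
      ≤ m := by
  set R := (Finset.range T).filter fun i => e ∈ g.offers (g.run i) ∧ e ∉ g.accepted (g.run i)
  have h1 : R.card * g.cap (g.dst e) ≤ d (g.dst e) := by
    calc R.card * g.cap (g.dst e)
        = ∑ i ∈ R, ((g.accepted (g.run i)).filter (g.dst · = g.dst e)).card := by
          rw [← smul_eq_mul, ← Finset.sum_const]
          refine Finset.sum_congr rfl fun i hi => ?_
          obtain ⟨-, h1, h2⟩ := Finset.mem_filter.1 hi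
          rw [accepted_filter_dst]
          have hm : e ∈ (g.offers (g.run i)).filter fun f => g.dst f = g.dst e :=
            Finset.mem_filter.2 ⟨h1, rfl⟩
          refine (card_take_of_notMem hm fun h => h2 ?_).symm
          exact Finset.mem_filter.2 ⟨(g.mem_offers _ h1).1, h1, h⟩
      _ ≤ ∑ i ∈ Finset.range T, ((g.accepted (g.run i)).filter (g.dst · = g.dst e)).card :=
          Finset.sum_le_sum_of_subset (Finset.filter_subset _ _)
      _ = ((g.run T).used.filter (g.dst · = g.dst e)).card := (g.card_used_filter _ T).symm
      _ ≤ _ := Finset.card_le_card (Finset.filter_subset_filter _ (g.used_subset_arcs T))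
      _ ≤ d (g.dst e) := hin _
  exact Nat.le_of_mul_le_mul_right (h1.trans (hd _)) (hcap _)

theorem card_accepted_times_le (T : ℕ) (e : ε) :
    ((Finset.range T).filter fun i => e ∈ g.accepted (g.run i)).card ≤ 1 := by
  refine Finset.card_le_one.2 fun i hi j hj => ?_
  have key : ∀ i j, e ∈ g.accepted (g.run i) → e ∈ g.accepted (g.run j) → ¬ i < j := by
    intro i j hi hj hij
    have h1 : e ∈ (g.run (i + 1)).used := Finset.mem_union_right _ hi
    exact (g.mem_offers _ (g.accepted_subset_offers _ hj)).2.1 (g.used_mono hij h1)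
  have h1 := (Finset.mem_filter.1 hi).2
  have h2 := (Finset.mem_filter.1 hj).2
  have := key i j h1 h2
  have := key j i h2 h1
  omega

theorem card_offered_le (hcap : ∀ v, 0 < g.cap v) (hd : ∀ v, d v ≤ m * g.cap v)
    (hin : ∀ v, (g.arcs.filter (g.dst · = v)).card ≤ d v) (T : ℕ) (e : ε) :
    ((Finset.range T).filter fun i => e ∈ g.offers (g.run i)).card ≤ m + 1 := by
  calc _ ≤ ((Finset.range T).filter
          fun i => e ∈ g.offers (g.run i) ∧ e ∉ g.accepted (g.run i)).card +
        ((Finset.range T).filter fun i => e ∈ g.accepted (g.run i)).card := by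
        refine (Finset.card_le_card fun i hi => ?_).trans (Finset.card_union_le _ _)
        simp only [Finset.mem_union, Finset.mem_filter] at hi ⊢
        tauto
    _ ≤ m + 1 := add_le_add (g.card_refused_le hcap hd hin T e) (g.card_accepted_times_le T e)

/-- The number of phases in which a node makes as many offers as it can. -/
theorem card_full_offers_le (hcap : ∀ v, 0 < g.cap v) (hd : ∀ v, d v ≤ m * g.cap v)
    (hin : ∀ v, (g.arcs.filter (g.dst · = v)).card ≤ d v)
    (hout : ∀ v, (g.arcs.filter (g.src · = v)).card ≤ d v) (T : ℕ) (v : N) :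
    ((Finset.range T).filter fun i =>
      ((g.offers (g.run i)).filter (g.src · = v)).card = g.cap v).card ≤ m * (m + 1) := by
  set R := (Finset.range T).filter fun i =>
      ((g.offers (g.run i)).filter (g.src · = v)).card = g.cap v
  have h1 : R.card * g.cap v ≤ m * g.cap v * (m + 1) := by
    calc R.card * g.cap v
        = ∑ i ∈ R, ((g.offers (g.run i)).filter (g.src · = v)).card := by
          rw [← smul_eq_mul, ← Finset.sum_const]
          exact Finset.sum_congr rfl fun i hi => (Finset.mem_filter.1 hi).2.symm
      _ ≤ ∑ i ∈ Finset.range T, ((g.offers (g.run i)).filter (g.src · = v)).card :=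
          Finset.sum_le_sum_of_subset (Finset.filter_subset _ _)
      -- Double counting of the pairs of a phase and an arc of `v` offered in it; each arc is
      -- offered at most `m + 1` times.
      _ = ∑ i ∈ Finset.range T, ((g.arcs.filter (g.src · = v)).filter
            fun e => e ∈ g.offers (g.run i)).card := by
          refine Finset.sum_congr rfl fun i _ => congrArg _ ?_
          ext e
          simp only [Finset.mem_filter]
          exact ⟨fun h => ⟨⟨(g.mem_offers _ h.1).1, h.2⟩, h.1⟩, fun h => ⟨h.2, h.1.2⟩⟩
      _ = ∑ e ∈ g.arcs.filter (g.src · = v),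
            ((Finset.range T).filter fun i => e ∈ g.offers (g.run i)).card :=
          (Finset.sum_card_bipartiteAbove_eq_sum_card_bipartiteBelow
            (fun i e => e ∈ g.offers (g.run i)))
      _ ≤ (g.arcs.filter (g.src · = v)).card * (m + 1) := by
          rw [← smul_eq_mul, ← Finset.sum_const]
          exact Finset.sum_le_sum fun e _ => g.card_offered_le hcap hd hin T e
      _ ≤ m * g.cap v * (m + 1) := Nat.mul_le_mul_right _ ((hout v).trans (hd v))
  refine Nat.le_of_mul_le_mul_right (h1.trans (le_of_eq ?_)) (hcap v)
  ring

/-- Along an unused arc, the numbers of settled tokens do not drop by much. -/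
theorem passive_src_le (hcap : ∀ v, 0 < g.cap v) (hd : ∀ v, d v ≤ m * g.cap v)
    (hin : ∀ v, (g.arcs.filter (g.dst · = v)).card ≤ d v)
    (hout : ∀ v, (g.arcs.filter (g.src · = v)).card ≤ d v) {T : ℕ} {e : ε} (he : e ∈ g.arcs)
    (hu : e ∉ (g.run T).used) :
    (g.run T).passive (g.src e) ≤ (g.run T).passive (g.dst e) + g.rate * (m * (m + 2)) := by
  rw [passive_eq, passive_eq, ← mul_add]
  refine Nat.mul_le_mul_left _ ?_
  -- When the source is busy and the target is not, `e` is a candidate. As it stays unused, either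
  -- it was offered and refused, at most `m` times, or a full quota of other offers displaced it, at
  -- most `m * (m + 1)` times.
  have hsub : (Finset.range T).filter (fun i => g.Busy (g.run i) (g.src e)) ⊆
      (Finset.range T).filter (fun i => g.Busy (g.run i) (g.dst e)) ∪
        (((Finset.range T).filter fun i =>
          ((g.offers (g.run i)).filter (g.src · = g.src e)).card = g.cap (g.src e)) ∪
        (Finset.range T).filter fun i =>
          e ∈ g.offers (g.run i) ∧ e ∉ g.accepted (g.run i)) := by
    intro i hi
    simp only [Finset.mem_union, Finset.mem_filter] at hi ⊢
    by_cases hb : g.Busy (g.run i) (g.dst e)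
    · exact Or.inl ⟨hi.1, hb⟩
    have hui : e ∉ (g.run i).used := fun h =>
      hu (g.used_mono (Finset.mem_range.1 hi.1).le h)
    have hai : e ∉ g.accepted (g.run i) := fun h =>
      hu (g.used_mono (s := i + 1) (Finset.mem_range.1 hi.1) (Finset.mem_union_right _ h))
    by_cases ho : e ∈ g.offers (g.run i)
    · exact Or.inr (Or.inr ⟨hi.1, ho, hai⟩)
    · refine Or.inr (Or.inl ⟨hi.1, ?_⟩)
      rw [offers_filter_src _ _ hi.2]
      refine card_take_of_notMem (e := e) (Finset.mem_filter.2 ⟨he, hui, rfl, hb⟩) fun h => ho ?_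
      exact Finset.mem_filter.2 ⟨he, hi.2, h⟩
  have h1 := Finset.card_le_card hsub
  have h2 := g.card_full_offers_le hcap hd hin hout T (g.src e)
  have h3 := g.card_refused_le hcap hd hin T e
  have h4 := Finset.card_union_le
    ((Finset.range T).filter (fun i => g.Busy (g.run i) (g.dst e)))
    (((Finset.range T).filter fun i =>
          ((g.offers (g.run i)).filter (g.src · = g.src e)).card = g.cap (g.src e)) ∪
        (Finset.range T).filter fun i =>
          e ∈ g.offers (g.run i) ∧ e ∉ g.accepted (g.run i))
  have h5 := Finset.card_union_le ((Finset.range T).filter fun i =>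
          ((g.offers (g.run i)).filter (g.src · = g.src e)).card = g.cap (g.src e))
        ((Finset.range T).filter fun i =>
          e ∈ g.offers (g.run i) ∧ e ∉ g.accepted (g.run i))
  have h6 : m * (m + 2) = m * (m + 1) + m := by ring
  omega

end TokenGame

end DistributedColoring

namespace DistributedColoring

open scoped Classical

/-! ### Balanced orientations -/

/-- The data of a balanced orientation problem. Every edge has two endpoints `nd true e` and
`nd false e`. If it is oriented towards `nd true e`, then the load (the number of edges oriented
towards a node) of `nd true e` may exceed the load of `nd false e` by not much more than
`target e`; if it is oriented towards `nd false e`, then the load of `nd false e` may exceed the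
load of `nd true e` by not much more than `- target e`. The numbers `capDiv`, `steps`, and
`scale` are parameters of the algorithm. -/
structure Balancing (ε N : Type) where
  edges : Finset ε
  nd : Bool → ε → N
  target : ε → ℝ
  weight : ε → ℝ
  capDiv : ℕ
  steps : ℕ
  scale : ℕ

namespace Balancing

variable {ε N : Type} (p : Balancing ε N)

noncomputable def deg (v : N) : ℕ := (p.edges.filter fun e => ∃ b, p.nd b e = v).card

/-- The added one keeps the quota positive at small degrees and yields `deg_le_cap`. -/
noncomputable def cap (v : N) : ℕ := p.deg v / p.capDiv + 1

noncomputable def load (dir : ε → Option Bool) (v : N) : ℕ :=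
  (p.edges.filter fun e => ∃ b, dir e = some b ∧ p.nd b e = v).card

def sgn (b : Bool) : ℝ := if b then 1 else -1

theorem sgn_not (b : Bool) : sgn (!b) = -sgn b := by cases b <;> simp [sgn]

/-- By how much the difference of the loads exceeds the target if `e` is oriented to side `b`. -/
noncomputable def excess (dir : ε → Option Bool) (b : Bool) (e : ε) : ℝ :=
  p.load dir (p.nd b e) - p.load dir (p.nd (!b) e) - sgn b * p.target e

theorem excess_not (dir : ε → Option Bool) (b : Bool) (e : ε) :
    p.excess dir (!b) e = -p.excess dir b e := by
  simp only [excess, sgn_not, Bool.not_not]; ring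

/-- The side preferred by an edge. -/
noncomputable def pref (dir : ε → Option Bool) (e : ε) : Bool := decide (p.excess dir true e ≤ 0)

theorem excess_pref (dir : ε → Option Bool) (e : ε) : p.excess dir (p.pref dir e) e ≤ 0 := by
  by_cases h : p.excess dir true e ≤ 0
  · simp [pref, h]
  · have := p.excess_not dir true e
    simp only [Bool.not_true] at this
    simp only [pref, h, decide_false]
    linarith

variable (dir : ε → Option Bool) (δ : ℕ)

/-- The unoriented edges that want to be oriented towards `v`. -/
noncomputable def proposals (v : N) : Finset ε :=
  p.edges.filter fun e =>
    dir e = none ∧ (p.scale * δ : ℝ) ≤ p.weight e ∧ p.nd (p.pref dir e) e = v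

/-- The quota `steps * δ` is what a node can settle in `steps` phases of the game at rate `δ`, as
`TokenGame.active_le` requires. -/
noncomputable def inserted : Finset ε :=
  p.edges.filter fun e => e ∈ take (p.proposals dir δ (p.nd (p.pref dir e) e)) (p.steps * δ)

/-- The newly oriented edges are tokens, which move along overloaded edges by flipping them. -/
noncomputable def game : TokenGame ε N where
  arcs := p.edges.filter fun e => ∃ b, dir e = some b ∧ 0 < p.excess dir b e
  src e := p.nd ((dir e).getD true) e
  dst e := p.nd (!(dir e).getD true) e
  cap := p.cap
  rate := δ
  tokens v := ((p.inserted dir δ).filter fun e => p.nd (p.pref dir e) e = v).card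

noncomputable def phase (e : ε) : Option Bool :=
  if e ∈ p.inserted dir δ then some (p.pref dir e)
  else if e ∈ ((p.game dir δ).run p.steps).used then (dir e).map (!·) else dir e

theorem mem_inserted {e : ε} (he : e ∈ p.inserted dir δ) :
    e ∈ p.edges ∧ dir e = none ∧ (p.scale * δ : ℝ) ≤ p.weight e := by
  obtain ⟨h1, h2⟩ := Finset.mem_filter.1 he
  obtain ⟨-, h3, h4, -⟩ := Finset.mem_filter.1 (take_subset _ _ h2)
  exact ⟨h1, h3, h4⟩

theorem inserted_filter (v : N) :
    (p.inserted dir δ).filter (fun e => p.nd (p.pref dir e) e = v) =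
      take (p.proposals dir δ v) (p.steps * δ) := by
  ext e
  simp only [inserted, Finset.mem_filter]
  constructor
  · rintro ⟨⟨_, h⟩, rfl⟩; exact h
  · intro h
    obtain ⟨h1, _, _, rfl⟩ := Finset.mem_filter.1 (take_subset _ _ h)
    exact ⟨⟨h1, h⟩, rfl⟩

theorem tokens_le (v : N) : (p.game dir δ).tokens v ≤ p.steps * δ := by
  change (Finset.card _) ≤ _
  rw [inserted_filter, card_take]; exact min_le_left _ _

theorem mem_arcs {e : ε} : e ∈ (p.game dir δ).arcs ↔
    e ∈ p.edges ∧ ∃ b, dir e = some b ∧ 0 < p.excess dir b e := Finset.mem_filter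

theorem mem_used {e : ε} (he : e ∈ ((p.game dir δ).run p.steps).used) :
    e ∈ p.edges ∧ ∃ b, dir e = some b ∧ 0 < p.excess dir b e :=
  (p.mem_arcs dir δ).1 ((p.game dir δ).used_subset_arcs _ he)

variable (hnd : ∀ b b' e e', p.nd b e = p.nd b' e' → b = b')

-- Flipping a used arc moves one unit of load from its source to its target, and an inserted edge
-- adds one unit where its token starts. By conservation of tokens, the growth of the load is the
-- number of tokens finally present.
include hnd in
theorem load_phase (v : N) : p.load (p.phase dir δ) v = p.load dir v +
    (((p.game dir δ).run p.steps).active v + ((p.game dir δ).run p.steps).passive v) := by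
  have hc := (p.game dir δ).conservation p.steps v
  set U := ((p.game dir δ).run p.steps).used with hU
  set I := p.inserted dir δ with hI
  set O := p.edges.filter fun e => ∃ b, dir e = some b ∧ p.nd b e = v with hO
  have hnot : ∀ b e e', p.nd b e = p.nd (!b) e' → False := fun b e e' h => by
    have := hnd _ _ _ _ h; cases b <;> simp at this
  have hsub : U.filter (fun e => (p.game dir δ).src e = v) ⊆ O := by
    intro e he
    obtain ⟨h1, h2⟩ := Finset.mem_filter.1 he
    obtain ⟨h3, b, h4, -⟩ := p.mem_used dir δ h1
    simp only [game, h4, Option.getD_some] at h2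
    exact Finset.mem_filter.2 ⟨h3, b, h4, h2⟩
  -- After the phase, the edges directed to `v` are the old ones not flipped away, those flipped
  -- towards `v`, and the new ones.
  have hset : (p.edges.filter fun e => ∃ b, p.phase dir δ e = some b ∧ p.nd b e = v) =
      ((O \ U.filter fun e => (p.game dir δ).src e = v) ∪
        U.filter fun e => (p.game dir δ).dst e = v) ∪
        I.filter fun e => p.nd (p.pref dir e) e = v := by
    ext e
    simp only [Finset.mem_filter, Finset.mem_union, Finset.mem_sdiff, hO]
    by_cases heI : e ∈ I
    · obtain ⟨h1, h2, -⟩ := p.mem_inserted dir δ heI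
      have h3 : e ∉ U := fun h => by
        obtain ⟨-, b, h4, -⟩ := p.mem_used dir δ h
        simp [h2] at h4
      have h4 : p.phase dir δ e = some (p.pref dir e) := if_pos heI
      simp [h1, h2, h3, h4, heI]
    · by_cases heU : e ∈ U
      · obtain ⟨h1, b, h2, -⟩ := p.mem_used dir δ heU
        have h4 : p.phase dir δ e = some (!b) := by
          rw [phase, if_neg heI, if_pos heU, h2]; rfl
        simp only [heI, heU, h1, h2, h4, game, true_and, false_and, or_false, Option.getD_some,
          Option.some.injEq, exists_eq_left']
        tauto
      · have h4 : p.phase dir δ e = dir e := by rw [phase, if_neg heI, if_neg heU]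
        simp [heI, heU, h4]
  have hd1 : Disjoint ((O \ U.filter fun e => (p.game dir δ).src e = v) ∪
        U.filter fun e => (p.game dir δ).dst e = v)
        (I.filter fun e => p.nd (p.pref dir e) e = v) := by
    refine Finset.disjoint_left.2 fun e he he' => ?_
    obtain ⟨h1, h2, -⟩ := p.mem_inserted dir δ (Finset.mem_filter.1 he').1
    rcases Finset.mem_union.1 he with h | h
    · obtain ⟨-, b, hb, -⟩ := Finset.mem_filter.1 (Finset.mem_sdiff.1 h).1
      simp [h2] at hb
    · obtain ⟨-, b, hb, -⟩ := p.mem_used dir δ (Finset.mem_filter.1 h).1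
      simp [h2] at hb
  have hd2 : Disjoint (O \ U.filter fun e => (p.game dir δ).src e = v)
      (U.filter fun e => (p.game dir δ).dst e = v) := by
    refine Finset.disjoint_left.2 fun e he he' => ?_
    obtain ⟨-, b, hb, hb'⟩ := Finset.mem_filter.1 (Finset.mem_sdiff.1 he).1
    have := (Finset.mem_filter.1 he').2
    simp only [game, hb, Option.getD_some] at this
    exact hnot b e e (hb'.trans this.symm)
  have h1 : p.load (p.phase dir δ) v = O.card -
      (U.filter fun e => (p.game dir δ).src e = v).card +
      (U.filter fun e => (p.game dir δ).dst e = v).card +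
      (I.filter fun e => p.nd (p.pref dir e) e = v).card := by
    rw [load, hset, Finset.card_union_of_disjoint hd1, Finset.card_union_of_disjoint hd2,
      Finset.card_sdiff_of_subset hsub]
  have h2 := Finset.card_le_card hsub
  have h3 : p.load dir v = O.card := rfl
  have h4 : (p.game dir δ).tokens v = (I.filter fun e => p.nd (p.pref dir e) e = v).card := rfl
  omega

theorem cap_pos (v : N) : 0 < p.cap v := Nat.succ_pos _

theorem deg_le_cap (hm : 0 < p.capDiv) (v : N) : p.deg v ≤ p.capDiv * p.cap v :=
  (Nat.lt_mul_div_succ _ hm).le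

-- An inserted or flipped edge had nonpositive excess in its new direction, so only the load gained
-- by its head counts, which gives the second bound. An overloaded edge that is kept is an unused
-- arc: settled tokens differ by at most `δ * m * (m + 2)` along it, with `m = capDiv`, and the
-- active tokens add `2 * c + δ`.
include hnd in
theorem excess_phase_le (hm : 0 < p.capDiv) {e : ε} (he : e ∈ p.edges) {b : Bool}
    (hb : p.phase dir δ e = some b) {V c : ℝ} (hV : dir e = some b → p.excess dir b e ≤ V)
    (hc : ∀ b, (p.cap (p.nd b e) : ℝ) ≤ c) :
    p.excess (p.phase dir δ) b e ≤
        max (V + (2 * c + δ * (p.capDiv + 1) ^ 2)) (2 * c + (p.steps + 1) * δ) := by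
  set s := (p.game dir δ).run p.steps with hs
  have hact : ∀ b, (s.active (p.nd b e) : ℝ) ≤ 2 * c + δ := fun b => by
    have h1 := (p.game dir δ).active_le (p.nd b e) (p.tokens_le dir δ _)
    have h2 : (s.active (p.nd b e) : ℝ) ≤ 2 * p.cap (p.nd b e) + δ := by exact_mod_cast h1
    linarith [hc b]
  have hpas : ∀ b, (s.passive (p.nd b e) : ℝ) ≤ p.steps * δ := fun b => by
    exact_mod_cast (p.game dir δ).passive_le p.steps (p.nd b e)
  have hex : p.excess (p.phase dir δ) b e = p.excess dir b e +
      (s.active (p.nd b e) + s.passive (p.nd b e)) -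
      (s.active (p.nd (!b) e) + s.passive (p.nd (!b) e)) := by
    simp only [excess, p.load_phase dir δ hnd]
    push_cast
    ring
  have h0 : (0 : ℝ) ≤ s.active (p.nd (!b) e) := Nat.cast_nonneg _
  have h0' : (0 : ℝ) ≤ s.passive (p.nd (!b) e) := Nat.cast_nonneg _
  have hbase : p.excess dir b e ≤ 0 → p.excess (p.phase dir δ) b e ≤
        max (V + (2 * c + δ * (p.capDiv + 1) ^ 2)) (2 * c + (p.steps + 1) * δ) := fun h => by
    refine le_max_of_le_right ?_
    linarith [hact b, hpas b]
  by_cases heI : e ∈ p.inserted dir δ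
  · apply hbase
    rw [phase, if_pos heI, Option.some.injEq] at hb
    exact hb ▸ p.excess_pref dir e
  by_cases heU : e ∈ s.used
  · apply hbase
    obtain ⟨-, b', h2, h3⟩ := p.mem_used dir δ heU
    rw [phase, if_neg heI, if_pos heU, h2, Option.map_some, Option.some.injEq] at hb
    rw [← hb, excess_not]
    linarith
  rw [phase, if_neg heI, if_neg heU] at hb
  by_cases hpos : p.excess dir b e ≤ 0
  · exact hbase hpos
  refine le_max_of_le_left ?_
  have harc : e ∈ (p.game dir δ).arcs := (p.mem_arcs dir δ).2 ⟨he, b, hb, not_le.1 hpos⟩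
  have h1 := (p.game dir δ).passive_src_le (d := p.deg) (m := p.capDiv) p.cap_pos
    (p.deg_le_cap hm) (fun v => Finset.card_le_card fun f hf => ?_)
    (fun v => Finset.card_le_card fun f hf => ?_) harc heU
  · have h2 : (p.game dir δ).src e = p.nd b e := by simp [game, hb]
    have h3 : (p.game dir δ).dst e = p.nd (!b) e := by simp [game, hb]
    rw [h2, h3] at h1
    have h4 : (s.passive (p.nd b e) : ℝ) ≤
        s.passive (p.nd (!b) e) + δ * (p.capDiv * (p.capDiv + 2)) := by exact_mod_cast h1
    have h5 : (δ : ℝ) * (p.capDiv + 1) ^ 2 = δ * (p.capDiv * (p.capDiv + 2)) + δ := by ring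
    linarith [hact b, hV hb]
  · obtain ⟨h2, h3⟩ := Finset.mem_filter.1 hf
    exact Finset.mem_filter.2 ⟨((p.mem_arcs dir δ).1 h2).1, _, h3⟩
  · obtain ⟨h2, h3⟩ := Finset.mem_filter.1 hf
    exact Finset.mem_filter.2 ⟨((p.mem_arcs dir δ).1 h2).1, _, h3⟩

theorem phase_ne_none {e : ε} (h : dir e ≠ none) : p.phase dir δ e ≠ none := by
  unfold phase
  split_ifs
  · simp
  · simpa using h
  · exact h

theorem eligible_of_phase_ne_none {e : ε} (h : dir e = none) (h' : p.phase dir δ e ≠ none) :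
    (p.scale * δ : ℝ) ≤ p.weight e := by
  by_cases heI : e ∈ p.inserted dir δ
  · exact (p.mem_inserted dir δ heI).2.2
  · rw [phase, if_neg heI, h] at h'
    simp at h'

/-- The number of oriented edges at a node. -/
noncomputable def oriented (v : N) : ℕ :=
  (p.edges.filter fun e => dir e ≠ none ∧ ∃ b, p.nd b e = v).card

theorem oriented_le (v : N) : p.oriented dir v ≤ p.deg v :=
  Finset.card_le_card fun _ he => by
    obtain ⟨h1, -, h2⟩ := Finset.mem_filter.1 he
    exact Finset.mem_filter.2 ⟨h1, h2⟩

theorem oriented_add_inserted_le (v : N) : p.oriented dir v +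
    ((p.inserted dir δ).filter fun e => p.nd (p.pref dir e) e = v).card ≤
      p.oriented (p.phase dir δ) v := by
  rw [oriented, ← Finset.card_union_of_disjoint]
  · refine Finset.card_le_card fun e he => ?_
    rcases Finset.mem_union.1 he with h | h
    · obtain ⟨h1, h2, h3⟩ := Finset.mem_filter.1 h
      exact Finset.mem_filter.2 ⟨h1, p.phase_ne_none dir δ h2, h3⟩
    · obtain ⟨h1, h2⟩ := Finset.mem_filter.1 h
      refine Finset.mem_filter.2 ⟨(p.mem_inserted dir δ h1).1, ?_, _, h2⟩
      rw [phase, if_pos h1]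
      simp
  · refine Finset.disjoint_left.2 fun e he he' => ?_
    exact (Finset.mem_filter.1 he).2.1
      (p.mem_inserted dir δ (Finset.mem_filter.1 he').1).2.1

theorem oriented_mono (v : N) : p.oriented dir v ≤ p.oriented (p.phase dir δ) v :=
  (Nat.le_add_right _ _).trans (p.oriented_add_inserted_le dir δ v)

/-- If an eligible edge stays unoriented, then many edges at its endpoints become oriented. -/
theorem progress {e : ε} (he : e ∈ p.edges) (hw : (p.scale * δ : ℝ) ≤ p.weight e)
    (h : p.phase dir δ e = none) :
    p.oriented dir (p.nd true e) + p.oriented dir (p.nd false e) + p.steps * δ ≤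
      p.oriented (p.phase dir δ) (p.nd true e) + p.oriented (p.phase dir δ) (p.nd false e) := by
  have hdir : dir e = none := by
    by_contra h'
    exact p.phase_ne_none dir δ h' h
  have heI : e ∉ p.inserted dir δ := fun h' => by
    rw [phase, if_pos h'] at h
    simp at h
  -- An eligible edge whose proposal is rejected witnesses a full quota at its preferred end.
  have hfull : ((p.inserted dir δ).filter
      fun f => p.nd (p.pref dir f) f = p.nd (p.pref dir e) e).card = p.steps * δ := by
    rw [inserted_filter]
    refine card_take_of_notMem (e := e) (Finset.mem_filter.2 ⟨he, hdir, hw, rfl⟩) fun h' => ?_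
    exact heI (Finset.mem_filter.2 ⟨he, h'⟩)
  have h1 := p.oriented_add_inserted_le dir δ (p.nd (p.pref dir e) e)
  rw [hfull] at h1
  have h2 := p.oriented_mono dir δ (p.nd true e)
  have h3 := p.oriented_mono dir δ (p.nd false e)
  -- The preferred end may change from phase to phase, which is why progress is measured by the sum
  -- over both ends.
  cases hp : p.pref dir e <;> rw [hp] at h1 <;> omega

/-! ### Iterating over all scales -/

variable (rates : ℕ → ℕ)

/-- The partial orientation after `i` phases. -/
noncomputable def orient : ℕ → ε → Option Bool
  | 0 => fun _ => none
  | i + 1 => p.phase (orient i) (rates i)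

theorem orient_ne_none_mono {e : ε} {i j : ℕ} (hij : i ≤ j) (h : p.orient rates i e ≠ none) :
    p.orient rates j e ≠ none := by
  induction j, hij using Nat.le_induction with
  | base => exact h
  | succ j _ ih => exact p.phase_ne_none _ _ ih

/-- An edge is eligible when it is inserted, and remains so because the rates only decrease. -/
theorem eligible_of_orient_ne_none (hr : Antitone rates) {e : ε} {i : ℕ}
    (h : p.orient rates (i + 1) e ≠ none) : (p.scale * rates i : ℝ) ≤ p.weight e := by
  induction i with
  | zero => exact p.eligible_of_phase_ne_none _ _ rfl h
  | succ i ih =>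
    by_cases h' : p.orient rates (i + 1) e = none
    · exact p.eligible_of_phase_ne_none _ _ h' h
    · refine le_trans ?_ (ih h')
      have : (rates (i + 1) : ℝ) ≤ rates i := by exact_mod_cast hr (Nat.le_succ i)
      gcongr

-- The first two terms are the cost of the latest insertion or flip, with the rate replaced by its
-- bound `weight / scale` from eligibility. The sum collects the drift over the phases at eligible
-- rates.
include hnd in
theorem excess_orient_le (hm : 0 < p.capDiv) (hQ : 0 < p.scale) (hr : Antitone rates) {e : ε}
    (he : e ∈ p.edges) {c : ℝ} (hc : ∀ b, (p.cap (p.nd b e) : ℝ) ≤ c) (i : ℕ) {b : Bool}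
    (hb : p.orient rates i e = some b) :
    p.excess (p.orient rates i) b e ≤ 2 * c + (p.steps + 1) * (p.weight e / p.scale) +
      ∑ k ∈ Finset.range i, if (p.scale * rates k : ℝ) ≤ p.weight e then
        2 * c + rates k * (p.capDiv + 1) ^ 2 else 0 := by
  have hc0 : 0 ≤ c := (Nat.cast_nonneg _).trans (hc true)
  induction i generalizing b with
  | zero => simp [orient] at hb
  | succ i ih =>
    have hel := p.eligible_of_orient_ne_none rates hr (e := e) (i := i) (by rw [hb]; simp)
    have h1 := p.excess_phase_le (p.orient rates i) (rates i) hnd hm he hb (fun h => ih h) hc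
    rw [Finset.sum_range_succ, if_pos hel]
    refine h1.trans (max_le (le_of_eq (by ring)) ?_)
    have h2 : (rates i : ℝ) ≤ p.weight e / p.scale := by
      rw [le_div_iff₀ (by exact_mod_cast hQ)]
      linarith
    have h3 : 0 ≤ ∑ k ∈ Finset.range i, if (p.scale * rates k : ℝ) ≤ p.weight e then
        2 * c + rates k * ((p.capDiv : ℝ) + 1) ^ 2 else 0 :=
      Finset.sum_nonneg fun k _ => by split_ifs <;> positivity
    have h4 : ((p.steps : ℝ) + 1) * rates i ≤ (p.steps + 1) * (p.weight e / p.scale) := by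
      gcongr
    have h5 : 0 ≤ 2 * c + (rates i : ℝ) * (p.capDiv + 1) ^ 2 := by positivity
    linarith

/-- As long as `e` is unoriented, each of the `P` phases orients `steps * δ` further edges at its
ends; their degrees do not allow this `P` times. -/
theorem orient_ne_none_of_scale {e : ε} (he : e ∈ p.edges) {i₀ P δ : ℕ}
    (hrate : ∀ s < P, rates (i₀ + s) = δ) (hw : (p.scale * δ : ℝ) ≤ p.weight e)
    (hdeg : p.deg (p.nd true e) + p.deg (p.nd false e) < P * (p.steps * δ)) :
    p.orient rates (i₀ + P) e ≠ none := by
  intro h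
  have key : ∀ s ≤ P, s * (p.steps * δ) ≤ p.oriented (p.orient rates (i₀ + s)) (p.nd true e) +
      p.oriented (p.orient rates (i₀ + s)) (p.nd false e) := by
    intro s
    induction s with
    | zero => intro _; simp
    | succ s ih =>
      intro hs
      have h1 := p.progress (p.orient rates (i₀ + s)) δ he hw (by
        have : p.orient rates (i₀ + (s + 1)) e = none := by
          by_contra h'
          exact p.orient_ne_none_mono rates (by omega) h' h
        rw [← hrate s (by omega)]
        exact this)
      have h2 := ih (by omega)
      have h3 : p.orient rates (i₀ + (s + 1)) = p.phase (p.orient rates (i₀ + s)) δ := by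
        rw [← hrate s (by omega)]; rfl
      rw [h3, add_mul, one_mul]
      omega
  have h1 := key P le_rfl
  have h2 := p.oriented_le (p.orient rates (i₀ + P)) (p.nd true e)
  have h3 := p.oriented_le (p.orient rates (i₀ + P)) (p.nd false e)
  omega

end Balancing

end DistributedColoring

/-! ### Geometric rates, choice of parameters, and the error of the final orientation -/

namespace DistributedColoring

open scoped Classical

namespace Balancing

/-- The rates `2 ^ J, …, 2, 1`, each of them used for `P` phases. -/
def geomRate (P J i : ℕ) : ℕ := 2 ^ (J - i / P)

theorem geomRate_antitone (P J : ℕ) : Antitone (geomRate P J) := fun _ _ h =>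
  Nat.pow_le_pow_right two_pos (Nat.sub_le_sub_left (Nat.div_le_div_right h) _)

theorem sum_range_mul_div {P : ℕ} (hP : 0 < P) (g : ℕ → ℝ) (n : ℕ) :
    ∑ i ∈ Finset.range (n * P), g (i / P) = P * ∑ j ∈ Finset.range n, g j := by
  induction n with
  | zero => simp
  | succ n ih =>
    rw [add_mul, one_mul, Finset.sum_range_add, ih, Finset.sum_range_succ, mul_add]
    congr 1
    rw [← nsmul_eq_mul]
    conv_rhs => rw [← Finset.card_range P, ← Finset.sum_const]
    refine Finset.sum_congr rfl fun i hi => ?_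
    rw [mul_comm n P, Nat.mul_add_div hP, Nat.div_eq_of_lt (Finset.mem_range.1 hi), add_zero]

/-- The largest admitted power of two is at most `w / Q` and exceeds the sum of the smaller ones. -/
theorem sum_geom_le (Q w : ℝ) (hQ : 0 < Q) (hw : 0 ≤ w) (n : ℕ) :
    ∑ j ∈ Finset.range n, (if Q * 2 ^ j ≤ w then (2 : ℝ) ^ j else 0) ≤ 2 * (w / Q) := by
  induction n with
  | zero => simp; positivity
  | succ n ih =>
    rw [Finset.sum_range_succ]
    split_ifs with h
    · have h1 : ∑ j ∈ Finset.range n, (if Q * 2 ^ j ≤ w then (2 : ℝ) ^ j else 0) ≤ 2 ^ n := by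
        calc _ ≤ ∑ j ∈ Finset.range n, (2 : ℝ) ^ j :=
              Finset.sum_le_sum fun j _ => by split_ifs; exacts [le_rfl, by positivity]
          _ = 2 ^ n - 1 := by rw [geom_sum_eq (by norm_num)]; norm_num
          _ ≤ _ := by linarith
      have h2 : (2 : ℝ) ^ n ≤ w / Q := by rw [le_div_iff₀ hQ]; linarith
      linarith
    · simpa using ih

theorem sum_geomRate_le {P : ℕ} (hP : 0 < P) (J : ℕ) {Q w c r : ℝ} (hQ : 0 < Q) (hw : 0 ≤ w)
    (hc : 0 ≤ c) (hr : 0 ≤ r) :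
    ∑ i ∈ Finset.range ((J + 1) * P), (if Q * geomRate P J i ≤ w then c + geomRate P J i * r else 0)
      ≤ (J + 1) * P * c + P * (2 * (w / Q)) * r := by
  calc _ ≤ ∑ i ∈ Finset.range ((J + 1) * P),
        (c + (if Q * 2 ^ (J - i / P) ≤ w then (2 : ℝ) ^ (J - i / P) else 0) * r) := by
        refine Finset.sum_le_sum fun i _ => ?_
        simp only [geomRate, Nat.cast_pow, Nat.cast_ofNat]
        split_ifs
        · exact le_rfl
        · linarith
    _ = (J + 1) * P * c + P * (∑ j ∈ Finset.range (J + 1),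
          (if Q * 2 ^ (J - j) ≤ w then (2 : ℝ) ^ (J - j) else 0)) * r := by
        rw [Finset.sum_add_distrib, ← Finset.sum_mul,
          sum_range_mul_div hP (fun j => if Q * 2 ^ (J - j) ≤ w then (2 : ℝ) ^ (J - j) else 0)]
        simp
    _ = (J + 1) * P * c + P * (∑ j ∈ Finset.range (J + 1),
          (if Q * 2 ^ j ≤ w then (2 : ℝ) ^ j else 0)) * r := by
        rw [← Finset.sum_range_reflect]
        congr 3
        refine Finset.sum_congr rfl fun j hj => ?_
        have : J - (J + 1 - 1 - j) = j := by have := Finset.mem_range.1 hj; omega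
        rw [this]
    _ ≤ _ := by
        have := sum_geom_le Q w hQ hw (J + 1)
        gcongr

end Balancing

/-- The number of phases per scale. -/
def phases (ℓ : ℕ) : ℕ := 64 * ℓ + 1

/-- Quotas are so small a fraction of the weight that their total over all `(J + 1) * phases ℓ`
phases stays below `weight / (16 * ℓ)`. -/
def capDivisor (ℓ J : ℕ) : ℕ := 128 * ℓ * phases ℓ * (J + 1)

/-- Makes the cost of one insertion comparable to the drift over the phases of one scale;
`threshold` then bounds each of them by `weight / (16 * ℓ)`. -/
def gameSteps (ℓ J : ℕ) : ℕ := phases ℓ * (capDivisor ℓ J + 1) ^ 2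

/-- Edges of smaller weight than this are not oriented. -/
def threshold (ℓ J : ℕ) : ℕ := 32 * ℓ * gameSteps ℓ J

namespace Balancing

variable {ε N : Type}

/-- A balancing problem with the parameters for relative error `1 / (4 * ℓ)` and degrees up to
`2 ^ J`. -/
def standard (ℓ J : ℕ) (edges : Finset ε) (nd : Bool → ε → N) (target weight : ε → ℝ) :
    Balancing ε N := ⟨edges, nd, target, weight, capDivisor ℓ J, gameSteps ℓ J, threshold ℓ J⟩

/-- The orientation of the edges computed after all phases. -/
noncomputable def final (ℓ J : ℕ) (p : Balancing ε N) : ε → Option Bool :=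
  p.orient (geomRate (phases ℓ) J) ((J + 1) * phases ℓ)

variable {ℓ J : ℕ} {edges : Finset ε} {nd : Bool → ε → N} {target weight : ε → ℝ}

theorem final_ne_none (hℓ : 0 < ℓ) {e : ε} (he : e ∈ edges)
    (hw : (threshold ℓ J : ℝ) ≤ weight e)
    (hdeg : ((standard ℓ J edges nd target weight).deg (nd true e) : ℝ) +
      (standard ℓ J edges nd target weight).deg (nd false e) ≤ weight e)
    (hJ : ∀ b, (standard ℓ J edges nd target weight).deg (nd b e) ≤ 2 ^ J) :
    final ℓ J (standard ℓ J edges nd target weight) e ≠ none := by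
  set p := standard ℓ J edges nd target weight with hp
  have hP : 0 < phases ℓ := Nat.succ_pos _
  have hT : 0 < gameSteps ℓ J := by unfold gameSteps; positivity
  -- The coarsest scale at which `e` is eligible. Unless it is the top scale, the weight, and with
  -- it the degree sum, is below `threshold * 2 ^ (j + 1)`; at the top scale `hJ` bounds the degrees
  -- instead.
  have hex : ∃ j, j ≤ J ∧ (threshold ℓ J * 2 ^ j : ℝ) ≤ weight e ∧
      (j = J ∨ weight e < threshold ℓ J * 2 ^ (j + 1)) := by
    have : ∀ n ≤ J, ∃ j, j ≤ n ∧ (threshold ℓ J * 2 ^ j : ℝ) ≤ weight e ∧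
      (j = n ∨ weight e < threshold ℓ J * 2 ^ (j + 1)) := by
      intro n
      induction n with
      | zero => intro _; exact ⟨0, le_rfl, by simpa using hw, Or.inl rfl⟩
      | succ n ih =>
        intro hn
        obtain ⟨j, h1, h2, h3⟩ := ih (by omega)
        by_cases hj : (threshold ℓ J * 2 ^ (n + 1) : ℝ) ≤ weight e
        · exact ⟨n + 1, le_rfl, hj, Or.inl rfl⟩
        · refine ⟨j, by omega, h2, Or.inr ?_⟩
          rcases h3 with rfl | h3
          · exact not_le.1 hj
          · exact h3
    exact this J le_rfl
  obtain ⟨j, hjJ, hj1, hj2⟩ := hex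
  have hrate : ∀ s < phases ℓ, geomRate (phases ℓ) J ((J - j) * phases ℓ + s) = 2 ^ j := by
    intro s hs
    unfold geomRate
    rw [mul_comm (J - j), Nat.mul_add_div hP, Nat.div_eq_of_lt hs]
    congr 1
    omega
  have hlt : p.deg (nd true e) + p.deg (nd false e) < phases ℓ * (p.steps * 2 ^ j) := by
    have h1 : p.deg (nd true e) + p.deg (nd false e) ≤ 2 * (threshold ℓ J * 2 ^ j) := by
      rcases hj2 with rfl | h
      · have h2 := hJ true
        have h3 := hJ false
        have h4 : 1 ≤ threshold ℓ j := by
          unfold threshold; exact Nat.succ_le_of_lt (by positivity)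
        nlinarith [pow_pos (two_pos : (0 : ℕ) < 2) j]
      · have h2 := hdeg.trans h.le
        rw [pow_succ] at h2
        have h3 : ((p.deg (nd true e) + p.deg (nd false e) : ℕ) : ℝ) ≤
            ((2 * (threshold ℓ J * 2 ^ j) : ℕ) : ℝ) := by push_cast; linarith
        exact_mod_cast h3
    refine h1.trans_lt ?_
    -- This comparison fixes `phases ℓ = 64 * ℓ + 1`.
    change 2 * (32 * ℓ * gameSteps ℓ J * 2 ^ j) < (64 * ℓ + 1) * (gameSteps ℓ J * 2 ^ j)
    have : 0 < gameSteps ℓ J * 2 ^ j := by positivity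
    nlinarith
  have h := p.orient_ne_none_of_scale (geomRate (phases ℓ) J) he hrate (by
    push_cast; exact hj1) hlt
  refine p.orient_ne_none_mono _ ?_ h
  calc (J - j) * phases ℓ + phases ℓ = (J - j + 1) * phases ℓ := by ring
    _ ≤ (J + 1) * phases ℓ := Nat.mul_le_mul_right _ (by omega)

/-- Three errors of at most `weight / (16 * ℓ)` each: from the latest insertion or flip (`b2`), from
the drift of settled tokens (`b3`), and from the quotas (`b4`). -/
theorem excess_final_le (hℓ : 0 < ℓ) (hnd : ∀ b b' e e', nd b e = nd b' e' → b = b') {e : ε}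
    (he : e ∈ edges) (hw : (threshold ℓ J : ℝ) ≤ weight e)
    (hdeg : ((standard ℓ J edges nd target weight).deg (nd true e) : ℝ) +
      (standard ℓ J edges nd target weight).deg (nd false e) ≤ weight e) {b : Bool}
    (hb : final ℓ J (standard ℓ J edges nd target weight) e = some b) :
    (standard ℓ J edges nd target weight).excess
      (final ℓ J (standard ℓ J edges nd target weight)) b e ≤ weight e / (4 * ℓ) := by
  set p := standard ℓ J edges nd target weight with hp
  have hP : 0 < phases ℓ := Nat.succ_pos _
  have hT : 0 < gameSteps ℓ J := by unfold gameSteps; positivity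
  have hQ : 0 < threshold ℓ J := by unfold threshold; positivity
  have hm : 0 < capDivisor ℓ J := by unfold capDivisor; positivity
  have hw0 : 0 ≤ weight e := le_trans (Nat.cast_nonneg _) hw
  set w := weight e with hwdef
  have hcap : ∀ b, (p.cap (nd b e) : ℝ) ≤ w / capDivisor ℓ J + 1 := by
    intro b
    have h1 : (p.deg (nd b e) : ℝ) ≤ w := by
      have h2 : (0 : ℝ) ≤ p.deg (nd true e) := Nat.cast_nonneg _
      have h3 : (0 : ℝ) ≤ p.deg (nd false e) := Nat.cast_nonneg _
      cases b <;> linarith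
    have h2 : ((p.deg (nd b e) / capDivisor ℓ J : ℕ) : ℝ) ≤ p.deg (nd b e) / capDivisor ℓ J :=
      Nat.cast_div_le
    have h3 : (p.deg (nd b e) : ℝ) / capDivisor ℓ J ≤ w / capDivisor ℓ J := by gcongr
    have h4 : (p.cap (nd b e) : ℝ) = ((p.deg (nd b e) / capDivisor ℓ J : ℕ) : ℝ) + 1 := by
      simp only [cap]; push_cast; rfl
    linarith
  have h1 := p.excess_orient_le hnd (geomRate (phases ℓ) J) hm hQ (geomRate_antitone _ _) he hcap
    ((J + 1) * phases ℓ) hb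
  have h2 := sum_geomRate_le hP J (Q := threshold ℓ J) (w := w)
    (c := 2 * (w / capDivisor ℓ J + 1)) (r := (capDivisor ℓ J + 1) ^ 2)
    (by exact_mod_cast hQ) hw0 (by positivity) (by positivity)
  refine (h1.trans (add_le_add_right h2 _)).trans ?_
  change 2 * (w / capDivisor ℓ J + 1) + (gameSteps ℓ J + 1) * (w / threshold ℓ J) +
    ((J + 1) * phases ℓ * (2 * (w / capDivisor ℓ J + 1)) +
      phases ℓ * (2 * (w / threshold ℓ J)) * (capDivisor ℓ J + 1) ^ 2) ≤ w / (4 * ℓ)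
  have hℓ' : (0 : ℝ) < ℓ := by exact_mod_cast hℓ
  have hP1 : (1 : ℝ) ≤ phases ℓ := by exact_mod_cast hP
  have hT1 : (1 : ℝ) ≤ gameSteps ℓ J := by exact_mod_cast hT
  have hm1 : (1 : ℝ) ≤ capDivisor ℓ J := by exact_mod_cast hm
  have hQ1 : (0 : ℝ) < threshold ℓ J := by exact_mod_cast hQ
  have eT : (gameSteps ℓ J : ℝ) = phases ℓ * (capDivisor ℓ J + 1) ^ 2 := by
    simp [gameSteps]
  have eQ : (threshold ℓ J : ℝ) = 32 * ℓ * gameSteps ℓ J := by simp [threshold]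
  have em : (capDivisor ℓ J : ℝ) = 128 * ℓ * (phases ℓ * (J + 1)) := by
    simp only [capDivisor]; push_cast; ring
  -- With the weight at least `capDivisor`, the rounding term 1 in `cap` is absorbed by doubling.
  have hmQ : (capDivisor ℓ J : ℝ) ≤ threshold ℓ J := by
    have hl1 : (1 : ℝ) ≤ ℓ := by exact_mod_cast hℓ
    have a1 : (capDivisor ℓ J : ℝ) ≤ (capDivisor ℓ J + 1) ^ 2 := by nlinarith
    have a2 : ((capDivisor ℓ J : ℝ) + 1) ^ 2 ≤ gameSteps ℓ J := by
      rw [eT]; exact le_mul_of_one_le_left (by positivity) hP1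
    have a3 : (gameSteps ℓ J : ℝ) ≤ threshold ℓ J := by rw [eQ]; nlinarith
    linarith
  have b1 : w / capDivisor ℓ J + 1 ≤ 2 * (w / capDivisor ℓ J) := by
    have : 1 ≤ w / capDivisor ℓ J := by
      rw [le_div_iff₀ (by positivity)]; linarith
    linarith
  have b2 : ((gameSteps ℓ J : ℝ) + 1) * (w / threshold ℓ J) ≤ w / (16 * ℓ) := by
    calc ((gameSteps ℓ J : ℝ) + 1) * (w / threshold ℓ J)
        ≤ (2 * gameSteps ℓ J) * (w / threshold ℓ J) := by gcongr; linarith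
      _ = w / (16 * ℓ) := by rw [eQ]; field_simp; ring
  have b3 : phases ℓ * (2 * (w / threshold ℓ J)) * ((capDivisor ℓ J : ℝ) + 1) ^ 2 = w / (16 * ℓ) := by
    calc phases ℓ * (2 * (w / threshold ℓ J)) * ((capDivisor ℓ J : ℝ) + 1) ^ 2
        = 2 * gameSteps ℓ J * (w / threshold ℓ J) := by rw [eT]; ring
      _ = w / (16 * ℓ) := by rw [eQ]; field_simp; ring
  have hX1 : (1 : ℝ) ≤ phases ℓ * (J + 1) := by
    have : (1 : ℝ) ≤ J + 1 := by linarith [(Nat.cast_nonneg J : (0 : ℝ) ≤ J)]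
    nlinarith
  have b4 : 2 * (w / capDivisor ℓ J + 1) +
      (J + 1) * phases ℓ * (2 * (w / capDivisor ℓ J + 1)) ≤ w / (16 * ℓ) := by
    calc _ = 2 * (1 + phases ℓ * (J + 1)) * (w / capDivisor ℓ J + 1) := by ring
      _ ≤ 2 * (2 * (phases ℓ * (J + 1))) * (2 * (w / capDivisor ℓ J)) := by gcongr; linarith
      _ = w / (16 * ℓ) := by rw [em]; field_simp; ring
  have b5 : w / (16 * ℓ) + w / (16 * ℓ) + w / (16 * ℓ) ≤ w / (4 * ℓ) := by
    have : w / (4 * ℓ) = 4 * (w / (16 * ℓ)) := by field_simp; norm_num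
    have : 0 ≤ w / (16 * ℓ) := by positivity
    linarith
  linarith

end Balancing

end DistributedColoring

namespace DistributedColoring

open scoped Classical

/-! ### Halving the color space -/

/-- The nodes of the subproblems: side, identifier, and key of the subproblem. -/
structure Node where
  side : Bool
  ident : ℕ
  key : ℕ

/-- The endpoint of `e` on side `b`, within the subproblem of `e`. -/
def node (key : LEdge → ℕ) (b : Bool) (e : LEdge) : Node :=
  ⟨b, if b then e.left else e.right, key e⟩

theorem side_eq_of_node_eq {key : LEdge → ℕ} {b b' : Bool} {e e' : LEdge}
    (h : node key b e = node key b' e') : b = b' := congrArg Node.side h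

/-- The number of edges in `A` at the endpoint of `e` on side `b` in the subproblem of `e`. -/
noncomputable def nodeDeg (A : Finset LEdge) (key : LEdge → ℕ) (b : Bool) (e : LEdge) : ℕ :=
  (A.filter fun f => ∃ b', node key b' f = node key b e).card

theorem exists_node_eq {key : LEdge → ℕ} {b : Bool} {e f : LEdge} :
    (∃ b', node key b' f = node key b e) ↔ node key b f = node key b e :=
  ⟨fun ⟨_, h⟩ => side_eq_of_node_eq h ▸ h, fun h => ⟨b, h⟩⟩

theorem nodeDeg_mono {A B : Finset LEdge} (h : A ⊆ B) (key : LEdge → ℕ) (b : Bool) (e : LEdge) :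
    nodeDeg A key b e ≤ nodeDeg B key b e := Finset.card_le_card (Finset.filter_subset_filter _ h)

theorem nodeDeg_pos {A : Finset LEdge} {key : LEdge → ℕ} {b : Bool} {e : LEdge} (he : e ∈ A) :
    0 < nodeDeg A key b e := Finset.card_pos.2 ⟨e, Finset.mem_filter.2 ⟨he, b, rfl⟩⟩

/-- The edges that are still present, the subproblem of every edge, and the current lists. -/
structure LevelState where
  alive : Finset LEdge
  key : LEdge → ℕ
  list : LEdge → Finset ℕ

/-- The slack that is left after `i` levels. -/
noncomputable def slackAt (ℓ i : ℕ) : ℝ := 2 / (1 + 1 / (2 * ℓ)) ^ i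

theorem slackAt_pos (ℓ i : ℕ) : 0 < slackAt ℓ i := by unfold slackAt; positivity

theorem slackAt_succ (ℓ i : ℕ) : slackAt ℓ i = slackAt ℓ (i + 1) * (1 + 1 / (2 * ℓ)) := by
  have h : (0 : ℝ) < 1 + 1 / (2 * ℓ) := by positivity
  unfold slackAt
  rw [pow_succ]
  field_simp

theorem slackAt_le_two (ℓ i : ℕ) : slackAt ℓ i ≤ 2 := by
  unfold slackAt
  apply div_le_self two_pos.le
  exact one_le_pow₀ (le_add_of_nonneg_right (by positivity))

/-- At most ℓ factors 1 + 1/(2ℓ) multiply to at most √e, which is below 2. -/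
theorem one_le_slackAt {ℓ i : ℕ} (h : i ≤ ℓ) : 1 ≤ slackAt ℓ i := by
  rcases Nat.eq_zero_or_pos ℓ with rfl | hℓ
  · obtain rfl : i = 0 := by omega
    simp [slackAt]
  unfold slackAt
  rw [le_div_iff₀ (by positivity), one_mul]
  have h0 : (0 : ℝ) < ℓ := by exact_mod_cast hℓ
  calc (1 + 1 / (2 * (ℓ : ℝ))) ^ i ≤ (1 + 1 / (2 * (ℓ : ℝ))) ^ ℓ :=
        pow_le_pow_right₀ (le_add_of_nonneg_right (by positivity)) h
    _ ≤ (Real.exp (1 / (2 * (ℓ : ℝ)))) ^ ℓ := by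
        gcongr
        linarith [Real.add_one_le_exp (1 / (2 * (ℓ : ℝ)))]
    _ = Real.exp (1 / 2) := by
        rw [← Real.exp_nat_mul]; congr 1; field_simp
    _ ≤ 2 := by
        have h1 : Real.exp (1 / 2) * Real.exp (1 / 2) = Real.exp 1 := by
          rw [← Real.exp_add]; norm_num
        have h2 := Real.exp_one_lt_d9
        have h3 := Real.exp_pos (1 / 2)
        nlinarith

section Level

variable (ℓ J : ℕ)

/-- The edges whose lists are large enough for another level. -/
noncomputable def big (i : ℕ) (s : LevelState) : Finset LEdge :=
  s.alive.filter fun e => threshold ℓ J * slackAt ℓ i ≤ (s.list e).card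

/-- By the slack condition, this bounds the degree sum of the edge in its subproblem. -/
noncomputable def levelWeight (i : ℕ) (s : LevelState) (e : LEdge) : ℝ :=
  (s.list e).card / slackAt ℓ i

/-- If `e` takes bit one, its new degree sum is the load at its `true` end plus degree minus load at
its `false` end. Bounding this by the number of remaining colors divided by the new slack gives the
target; the term `levelWeight / (4 * ℓ)` reserves room for the orientation error. -/
noncomputable def levelTarget (i : ℕ) (s : LevelState) (e : LEdge) : ℝ :=
  ((s.list e).filter fun c => c.testBit i = true).card / slackAt ℓ (i + 1) -
    levelWeight ℓ i s e / (4 * ℓ) - nodeDeg (big ℓ J i s) s.key false e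

noncomputable def levelBalancing (i : ℕ) (s : LevelState) : Balancing LEdge Node :=
  Balancing.standard ℓ J (big ℓ J i s) (node s.key) (levelTarget ℓ J i s) (levelWeight ℓ i s)

/-- Whether an edge continues with the colors whose `i`-th bit is one. -/
noncomputable def levelBit (i : ℕ) (s : LevelState) (e : LEdge) : Bool :=
  Balancing.final ℓ J (levelBalancing ℓ J i s) e == some true

/-- The key records the chosen bits in binary, so different keys mean disjoint lists. -/
noncomputable def nextLevel (i : ℕ) (s : LevelState) : LevelState where
  alive := big ℓ J i s
  key e := 2 * s.key e + (levelBit ℓ J i s e).toNat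
  list e := (s.list e).filter fun c => c.testBit i = levelBit ℓ J i s e

/-- The state after `i` levels. -/
noncomputable def level (E : Finset LEdge) : ℕ → LevelState
  | 0 => ⟨E, fun _ => 0, LEdge.colors⟩
  | i + 1 => nextLevel ℓ J i (level E i)

/-- The edges that are left out at level `i`. -/
noncomputable def small (E : Finset LEdge) (i : ℕ) : Finset LEdge :=
  (level ℓ J E i).alive \ (level ℓ J E (i + 1)).alive

/-- `e` is counted at both of its ends, so `nodeDeg_le` says that it has fewer neighbors in its
subproblem than colors; this is what the greedy coloring uses. At level 0 the double count can
violate `slack` for short lists, hence the restriction there to lists above the threshold. -/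
structure LevelState.Good (i : ℕ) (s : LevelState) : Prop where
  disjoint : ∀ e ∈ s.alive, ∀ f ∈ s.alive, s.key e ≠ s.key f → Disjoint (s.list e) (s.list f)
  bits : ∀ e ∈ s.alive, ∀ c ∈ s.list e, ∀ c' ∈ s.list e, ∀ k < i, c.testBit k = c'.testBit k
  nodeDeg_le : ∀ e ∈ s.alive,
    nodeDeg s.alive s.key true e + nodeDeg s.alive s.key false e ≤ (s.list e).card + 1
  slack : ∀ e ∈ s.alive, (0 < i ∨ threshold ℓ J * slackAt ℓ i ≤ (s.list e).card) →
    slackAt ℓ i * (nodeDeg s.alive s.key true e + nodeDeg s.alive s.key false e) ≤ (s.list e).card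
  nodeDeg_le_pow : ∀ b e, nodeDeg s.alive s.key b e ≤ 2 ^ J

variable {ℓ J}

theorem levelBit_eq {i : ℕ} {s : LevelState} {e : LEdge} {b : Bool}
    (h : Balancing.final ℓ J (levelBalancing ℓ J i s) e = some b) : levelBit ℓ J i s e = b := by
  rw [levelBit, h]; cases b <;> rfl

theorem nextLevel_key_eq {i : ℕ} {s : LevelState} {e f : LEdge} :
    (nextLevel ℓ J i s).key e = (nextLevel ℓ J i s).key f ↔
      s.key e = s.key f ∧ levelBit ℓ J i s e = levelBit ℓ J i s f := by
  simp only [nextLevel]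
  cases levelBit ℓ J i s e <;> cases levelBit ℓ J i s f <;> simp <;> omega

theorem nextLevel_node_eq {i : ℕ} {s : LevelState} {b : Bool} {e f : LEdge} :
    node (nextLevel ℓ J i s).key b f = node (nextLevel ℓ J i s).key b e ↔
      node s.key b f = node s.key b e ∧ levelBit ℓ J i s f = levelBit ℓ J i s e := by
  simp only [node, Node.mk.injEq, nextLevel_key_eq]
  tauto

theorem final_eq_some (hℓ : 0 < ℓ) {i : ℕ} {s : LevelState} (hs : s.Good ℓ J i) {e : LEdge}
    (he : e ∈ big ℓ J i s) : ∃ b,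
      Balancing.final ℓ J (levelBalancing ℓ J i s) e = some b ∧
      (levelBalancing ℓ J i s).excess (Balancing.final ℓ J (levelBalancing ℓ J i s)) b e ≤
        levelWeight ℓ i s e / (4 * ℓ) := by
  obtain ⟨h1, h2⟩ := Finset.mem_filter.1 he
  have hpos := slackAt_pos ℓ i
  have hw : (threshold ℓ J : ℝ) ≤ levelWeight ℓ i s e := by
    rw [levelWeight, le_div_iff₀ hpos]; exact h2
  have hsub : big ℓ J i s ⊆ s.alive := Finset.filter_subset _ _
  have hdeg : (nodeDeg (big ℓ J i s) s.key true e : ℝ) + nodeDeg (big ℓ J i s) s.key false e ≤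
      levelWeight ℓ i s e := by
    rw [levelWeight, le_div_iff₀ hpos, mul_comm]
    refine le_trans ?_ (hs.slack e h1 (Or.inr h2))
    have a1 : (nodeDeg (big ℓ J i s) s.key true e : ℝ) ≤ nodeDeg s.alive s.key true e := by
      exact_mod_cast nodeDeg_mono hsub _ _ _
    have a2 : (nodeDeg (big ℓ J i s) s.key false e : ℝ) ≤ nodeDeg s.alive s.key false e := by
      exact_mod_cast nodeDeg_mono hsub _ _ _
    gcongr
  have hne := Balancing.final_ne_none (target := levelTarget ℓ J i s) (nd := node s.key) hℓ he hw
    hdeg (fun b => (nodeDeg_mono hsub s.key b e).trans (hs.nodeDeg_le_pow b e))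
  obtain ⟨b, hb⟩ := Option.ne_none_iff_exists'.1 hne
  exact ⟨b, hb, Balancing.excess_final_le hℓ (fun _ _ _ _ h => side_eq_of_node_eq h) he hw hdeg hb⟩

theorem nodeDeg_nextLevel (hℓ : 0 < ℓ) {i : ℕ} {s : LevelState} (hs : s.Good ℓ J i) {e : LEdge}
    (he : e ∈ big ℓ J i s) :
    (nodeDeg (nextLevel ℓ J i s).alive (nextLevel ℓ J i s).key true e : ℝ) +
      nodeDeg (nextLevel ℓ J i s).alive (nextLevel ℓ J i s).key false e ≤
        ((nextLevel ℓ J i s).list e).card / slackAt ℓ (i + 1) := by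
  obtain ⟨b, hb, hexc⟩ := final_eq_some hℓ hs he
  have hbit := levelBit_eq hb
  have hpos := slackAt_pos ℓ (i + 1)
  set p := levelBalancing ℓ J i s with hp
  set dir := Balancing.final ℓ J p with hdir
  have hsome : ∀ f ∈ big ℓ J i s, ∀ b', levelBit ℓ J i s f = b' → dir f = some b' := by
    intro f hf b' h
    obtain ⟨b'', h1, -⟩ := final_eq_some hℓ hs hf
    rw [← h, levelBit_eq h1]; exact h1
  have h1 : nodeDeg (nextLevel ℓ J i s).alive (nextLevel ℓ J i s).key b e ≤
      p.load dir (node s.key b e) := by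
    refine Finset.card_le_card fun f hf => ?_
    obtain ⟨hf1, hf2⟩ := Finset.mem_filter.1 hf
    obtain ⟨hf3, hf4⟩ := nextLevel_node_eq.1 (exists_node_eq.1 hf2)
    exact Finset.mem_filter.2 ⟨hf1, b, hsome f hf1 b (hf4.trans hbit), hf3⟩
  -- At the other end, the edges sharing the bit of `e` are oriented away from that end, so they are
  -- disjoint from its load.
  have h2 : nodeDeg (nextLevel ℓ J i s).alive (nextLevel ℓ J i s).key (!b) e +
      p.load dir (node s.key (!b) e) ≤ nodeDeg (big ℓ J i s) s.key (!b) e := by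
    rw [nodeDeg, Balancing.load, ← Finset.card_union_of_disjoint]
    · refine Finset.card_le_card fun f hf => ?_
      rcases Finset.mem_union.1 hf with h | h
      · obtain ⟨hf1, hf2⟩ := Finset.mem_filter.1 h
        exact Finset.mem_filter.2
          ⟨hf1, exists_node_eq.2 (nextLevel_node_eq.1 (exists_node_eq.1 hf2)).1⟩
      · obtain ⟨hf1, b', hf2, hf3⟩ := Finset.mem_filter.1 h
        exact Finset.mem_filter.2 ⟨hf1, b', hf3⟩
    · refine Finset.disjoint_left.2 fun f hf hf' => ?_
      obtain ⟨hf1, hf2⟩ := Finset.mem_filter.1 hf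
      obtain ⟨-, b', hf3, hf4⟩ := Finset.mem_filter.1 hf'
      have h3 := hsome f hf1 b ((nextLevel_node_eq.1 (exists_node_eq.1 hf2)).2.trans hbit)
      have h4 : b' = !b := side_eq_of_node_eq hf4
      rw [h3, h4, Option.some.injEq] at hf3
      cases b <;> simp at hf3
  have h1' : (nodeDeg (nextLevel ℓ J i s).alive (nextLevel ℓ J i s).key b e : ℝ) ≤
      p.load dir (node s.key b e) := by exact_mod_cast h1
  have h2' : (nodeDeg (nextLevel ℓ J i s).alive (nextLevel ℓ J i s).key (!b) e : ℝ) +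
      p.load dir (node s.key (!b) e) ≤ nodeDeg (big ℓ J i s) s.key (!b) e := by exact_mod_cast h2
  have h3 : (p.load dir (node s.key b e) : ℝ) - p.load dir (node s.key (!b) e) -
      Balancing.sgn b * levelTarget ℓ J i s e ≤ levelWeight ℓ i s e / (4 * ℓ) := hexc
  have hlist : (nextLevel ℓ J i s).list e = (s.list e).filter fun c => c.testBit i = b := by
    rw [← hbit]; rfl
  have hℓ' : (0 : ℝ) < ℓ := by exact_mod_cast hℓ
  rw [hlist]
  cases b with
  | true =>
    simp only [Balancing.sgn, if_true, Bool.not_true, levelTarget] at h1' h2' h3 ⊢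
    linarith
  | false =>
    simp only [Balancing.sgn, Bool.not_false, levelTarget, Bool.false_eq_true, if_false]
      at h1' h2' h3 ⊢
    obtain ⟨he1, he2⟩ := Finset.mem_filter.1 he
    have h4 : (nodeDeg (big ℓ J i s) s.key true e : ℝ) + nodeDeg (big ℓ J i s) s.key false e ≤
        levelWeight ℓ i s e := by
      rw [levelWeight, le_div_iff₀ (slackAt_pos ℓ i), mul_comm]
      refine le_trans ?_ (hs.slack e he1 (Or.inr he2))
      have hsub : big ℓ J i s ⊆ s.alive := Finset.filter_subset _ _
      have a1 : (nodeDeg (big ℓ J i s) s.key true e : ℝ) ≤ nodeDeg s.alive s.key true e := by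
        exact_mod_cast nodeDeg_mono hsub _ _ _
      have a2 : (nodeDeg (big ℓ J i s) s.key false e : ℝ) ≤ nodeDeg s.alive s.key false e := by
        exact_mod_cast nodeDeg_mono hsub _ _ _
      have := slackAt_pos ℓ i
      gcongr
    have h5 : (((s.list e).filter fun c => c.testBit i = true).card : ℝ) +
        ((s.list e).filter fun c => c.testBit i = false).card = (s.list e).card := by
      have := Finset.card_filter_add_card_filter_not (s := s.list e)
        (fun c => c.testBit i = true)
      simp only [Bool.not_eq_true] at this
      exact_mod_cast this
    have h6 : levelWeight ℓ i s e * (1 + 1 / (2 * ℓ)) = (s.list e).card / slackAt ℓ (i + 1) := by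
      rw [levelWeight, slackAt_succ ℓ i]
      have : (0 : ℝ) < 1 + 1 / (2 * ℓ) := by positivity
      field_simp
    rw [← h5, add_div] at h6
    -- The loss of slack in one level pays twice for `levelWeight / (4 * ℓ)`: once for the reserve
    -- in the target, once for the orientation error.
    have h7 : levelWeight ℓ i s e * (1 + 1 / (2 * ℓ)) =
        levelWeight ℓ i s e + 2 * (levelWeight ℓ i s e / (4 * ℓ)) := by field_simp; ring
    linarith

theorem LevelState.Good.next {i : ℕ} (hi : i < ℓ) {s : LevelState} (hs : s.Good ℓ J i) :
    (nextLevel ℓ J i s).Good ℓ J (i + 1) := by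
  have hℓ : 0 < ℓ := by omega
  have hsub : big ℓ J i s ⊆ s.alive := Finset.filter_subset _ _
  have hslack : ∀ e ∈ (nextLevel ℓ J i s).alive, slackAt ℓ (i + 1) *
      (nodeDeg (nextLevel ℓ J i s).alive (nextLevel ℓ J i s).key true e +
        nodeDeg (nextLevel ℓ J i s).alive (nextLevel ℓ J i s).key false e) ≤
      ((nextLevel ℓ J i s).list e).card := fun e he => by
    have := nodeDeg_nextLevel hℓ hs he
    rw [le_div_iff₀ (slackAt_pos _ _)] at this
    linarith
  refine ⟨?_, ?_, ?_, fun e he _ => hslack e he, ?_⟩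
  · intro e he f hf hne
    by_cases hk : s.key e = s.key f
    · have hb : levelBit ℓ J i s e ≠ levelBit ℓ J i s f := fun h => hne (nextLevel_key_eq.2 ⟨hk, h⟩)
      refine Finset.disjoint_left.2 fun c hc hc' => hb ?_
      rw [← (Finset.mem_filter.1 hc).2, ← (Finset.mem_filter.1 hc').2]
    · exact (hs.disjoint e (hsub he) f (hsub hf) hk).mono (Finset.filter_subset _ _)
        (Finset.filter_subset _ _)
  · intro e he c hc c' hc' k hk
    obtain ⟨h1, h2⟩ := Finset.mem_filter.1 hc
    obtain ⟨h3, h4⟩ := Finset.mem_filter.1 hc'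
    rcases Nat.lt_succ_iff_lt_or_eq.1 hk with h | rfl
    · exact hs.bits e (hsub he) c h1 c' h3 k h
    · rw [h2, h4]
  · intro e he
    have h1 := hslack e he
    have h2 := one_le_slackAt (ℓ := ℓ) (i := i + 1) hi
    have h3 : ((nodeDeg (nextLevel ℓ J i s).alive (nextLevel ℓ J i s).key true e +
        nodeDeg (nextLevel ℓ J i s).alive (nextLevel ℓ J i s).key false e : ℕ) : ℝ) ≤
      (((nextLevel ℓ J i s).list e).card : ℕ) := by
      push_cast
      refine le_trans (le_mul_of_one_le_left (by positivity) h2) h1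
    exact (Nat.cast_le.1 h3).trans (Nat.le_succ _)
  · intro b e
    refine le_trans (Finset.card_le_card fun f hf => ?_) (hs.nodeDeg_le_pow b e)
    obtain ⟨hf1, hf2⟩ := Finset.mem_filter.1 hf
    exact Finset.mem_filter.2 ⟨hsub hf1,
      exists_node_eq.2 (nextLevel_node_eq.1 (exists_node_eq.1 hf2)).1⟩

/-- The conditions on an instance under which the algorithm finds a coloring. -/
structure Admissible (ℓ J : ℕ) (E : Finset LEdge) : Prop where
  lt_two_pow : ∀ e ∈ E, ∀ c ∈ e.colors, c < 2 ^ ℓ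
  nodeDeg_le : ∀ e ∈ E,
    nodeDeg E (fun _ => 0) true e + nodeDeg E (fun _ => 0) false e ≤ e.colors.card + 1
  slack : ∀ e ∈ E, threshold ℓ J * slackAt ℓ 0 ≤ e.colors.card →
    (2 : ℝ) * (nodeDeg E (fun _ => 0) true e + nodeDeg E (fun _ => 0) false e) ≤ e.colors.card
  nodeDeg_le_pow : ∀ b e, nodeDeg E (fun _ => 0) b e ≤ 2 ^ J

variable {E : Finset LEdge}

theorem level_good (hE : Admissible ℓ J E) {i : ℕ} (hi : i ≤ ℓ) :
    (level ℓ J E i).Good ℓ J i := by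
  induction i with
  | zero =>
    refine ⟨fun e _ f _ h => absurd rfl h, fun _ _ _ _ _ _ k hk => absurd hk (Nat.not_lt_zero k),
      hE.nodeDeg_le, fun e he h => ?_, hE.nodeDeg_le_pow⟩
    rcases h with h | h
    · exact absurd h (lt_irrefl 0)
    · have := hE.slack e he h
      simpa [slackAt, level] using this
  | succ i ih => exact (ih (by omega)).next hi

theorem level_alive_antitone : Antitone fun i => (level ℓ J E i).alive :=
  antitone_nat_of_succ_le fun _ => Finset.filter_subset _ _

theorem level_list_antitone (e : LEdge) : Antitone fun i => (level ℓ J E i).list e :=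
  antitone_nat_of_succ_le fun _ => Finset.filter_subset _ _

/-- After ℓ levels all bits are fixed, so a list has at most one color. An edge still present is
counted at both ends, and slack at least 1 would require two colors. -/
theorem level_alive_eq_empty (hℓ : 0 < ℓ) (hE : Admissible ℓ J E) :
    (level ℓ J E ℓ).alive = ∅ := by
  refine Finset.eq_empty_of_forall_notMem fun e he => ?_
  have hg := level_good hE le_rfl
  have heE : e ∈ E := level_alive_antitone (Nat.zero_le ℓ) he
  have hlt : ∀ c ∈ (level ℓ J E ℓ).list e, c < 2 ^ ℓ := fun c hc =>
    hE.lt_two_pow e heE c (level_list_antitone e (Nat.zero_le ℓ) hc)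
  have h1 : ((level ℓ J E ℓ).list e).card ≤ 1 := by
    refine Finset.card_le_one.2 fun c hc c' hc' => Nat.eq_of_testBit_eq fun k => ?_
    by_cases hk : k < ℓ
    · exact hg.bits e he c hc c' hc' k hk
    · have hpow : 2 ^ ℓ ≤ 2 ^ k := Nat.pow_le_pow_right two_pos (not_lt.1 hk)
      rw [Nat.testBit_eq_false_of_lt ((hlt c hc).trans_le hpow),
        Nat.testBit_eq_false_of_lt ((hlt c' hc').trans_le hpow)]
  have h2 := hg.slack e he (Or.inl hℓ)
  have h3 := one_le_slackAt (ℓ := ℓ) le_rfl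
  have h4 : (1 : ℝ) ≤ nodeDeg (level ℓ J E ℓ).alive (level ℓ J E ℓ).key true e := by
    exact_mod_cast nodeDeg_pos he
  have h5 : (1 : ℝ) ≤ nodeDeg (level ℓ J E ℓ).alive (level ℓ J E ℓ).key false e := by
    exact_mod_cast nodeDeg_pos he
  have h6 : (((level ℓ J E ℓ).list e).card : ℝ) ≤ 1 := by exact_mod_cast h1
  nlinarith

theorem exists_small (hℓ : 0 < ℓ) (hE : Admissible ℓ J E) {e : LEdge} (he : e ∈ E) :
    ∃ i < ℓ, e ∈ small ℓ J E i := by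
  by_contra h
  push Not at h
  have : ∀ i ≤ ℓ, e ∈ (level ℓ J E i).alive := by
    intro i
    induction i with
    | zero => intro _; exact he
    | succ i ih =>
      intro hi
      by_contra h'
      exact h i (by omega) (Finset.mem_sdiff.2 ⟨ih (by omega), h'⟩)
  have := this ℓ le_rfl
  simp [level_alive_eq_empty hℓ hE] at this

end Level

end DistributedColoring

namespace DistributedColoring

open scoped Classical

/-! ### Coloring the left-out edges greedily -/

/-- A numbering of the elements of `S`. -/
noncomputable def rank {ε : Type*} (S : Finset ε) (e : ε) : ℕ :=
  if h : e ∈ S then (S.equivFin ⟨e, h⟩).1 else 0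

theorem rank_lt {ε : Type*} {S : Finset ε} {e : ε} (h : e ∈ S) : rank S e < S.card := by
  rw [rank, dif_pos h]; exact Fin.isLt _

theorem rank_injOn {ε : Type*} (S : Finset ε) : Set.InjOn (rank S) S := by
  intro e he f hf h
  have he' : e ∈ S := he
  have hf' : f ∈ S := hf
  rw [rank, dif_pos he', rank, dif_pos hf'] at h
  exact congrArg Subtype.val (S.equivFin.injective (Fin.ext h))

/-- Distinct representatives of the sets `A e`, `e ∈ S`, if they exist. -/
noncomputable def representatives {ε : Type*} (S : Finset ε) (A : ε → Finset ℕ) : ε → ℕ :=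
  if h : ∃ f : ε → ℕ, (∀ e ∈ S, f e ∈ A e) ∧ Set.InjOn f S then h.choose else fun _ => 0

theorem representatives_spec {ε : Type*} {S : Finset ε} {A : ε → Finset ℕ}
    (h : ∃ f : ε → ℕ, (∀ e ∈ S, f e ∈ A e) ∧ Set.InjOn f S) :
    (∀ e ∈ S, representatives S A e ∈ A e) ∧ Set.InjOn (representatives S A) S := by
  rw [representatives, dif_pos h]; exact h.choose_spec

theorem representatives_congr {ε : Type*} {S : Finset ε} {A B : ε → Finset ℕ}
    (h : ∀ e ∈ S, A e = B e) : representatives S A = representatives S B := by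
  have : ∀ f : ε → ℕ, ((∀ e ∈ S, f e ∈ A e) ∧ Set.InjOn f S) ↔
      ((∀ e ∈ S, f e ∈ B e) ∧ Set.InjOn f S) := fun f =>
    and_congr_left fun _ => forall₂_congr fun e he => by rw [h e he]
  unfold representatives
  simp only [this]

/-- Greedy choice in any order: only the other sets meeting `A a` can have taken one of its
elements, and there are fewer of them than elements. -/
theorem exists_representatives {ε : Type*} (S : Finset ε) (A : ε → Finset ℕ)
    (h : ∀ e ∈ S, (S.filter fun f => ¬ Disjoint (A e) (A f)).card ≤ (A e).card)
    (hne : ∀ e ∈ S, (A e).Nonempty) :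
    ∃ f : ε → ℕ, (∀ e ∈ S, f e ∈ A e) ∧ Set.InjOn f S := by
  induction S using Finset.induction_on with
  | empty => exact ⟨fun _ => 0, by simp, by simp⟩
  | insert a S ha ih =>
    obtain ⟨f, hf1, hf2⟩ := ih (fun e he => (Finset.card_le_card
      (Finset.filter_subset_filter _ (Finset.subset_insert a S))).trans
        (h e (Finset.mem_insert_of_mem he))) (fun e he => hne e (Finset.mem_insert_of_mem he))
    have hex : ∃ c ∈ A a, ∀ e ∈ S, f e ≠ c := by
      by_contra hcon
      push Not at hcon
      have hsub : A a ⊆ (S.filter fun g => ¬ Disjoint (A a) (A g)).image f := by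
        intro c hc
        obtain ⟨e, he, rfl⟩ := hcon c hc
        exact Finset.mem_image_of_mem _ (Finset.mem_filter.2
          ⟨he, Finset.not_disjoint_iff.2 ⟨_, hc, hf1 e he⟩⟩)
      have h1 := (Finset.card_le_card hsub).trans Finset.card_image_le
      have h2 := h a (Finset.mem_insert_self a S)
      have h3 : ¬ Disjoint (A a) (A a) := by
        rw [disjoint_self]; exact (hne a (Finset.mem_insert_self a S)).ne_empty
      rw [Finset.filter_insert, if_pos h3, Finset.card_insert_of_notMem
        (fun h' => ha (Finset.mem_filter.1 h').1)] at h2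
      omega
    obtain ⟨c, hc1, hc2⟩ := hex
    refine ⟨Function.update f a c, fun e he => ?_, ?_⟩
    · rcases Finset.mem_insert.1 he with rfl | he
      · simpa using hc1
      · rw [Function.update_of_ne (ne_of_mem_of_not_mem he ha)]
        exact hf1 e he
    · have hupd : ∀ e ∈ S, Function.update f a c e = f e := fun e he =>
        Function.update_of_ne (ne_of_mem_of_not_mem he ha) _ _
      intro e he e' he' heq
      rcases Finset.mem_insert.1 he with h1 | h1 <;>
        rcases Finset.mem_insert.1 he' with h2 | h2
      · exact h1.trans h2.symm
      · rw [hupd _ h2, h1, Function.update_self] at heq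
        exact absurd heq.symm (hc2 _ h2)
      · rw [hupd _ h1, h2, Function.update_self] at heq
        exact absurd heq (hc2 _ h1)
      · rw [hupd _ h1, hupd _ h2] at heq
        exact hf2 h1 h2 heq

section Greedy

variable (ℓ J : ℕ) (E : Finset LEdge)

/-- An upper bound for the ranks of the edges that are left out. -/
def rankBound : ℕ := 2 * threshold ℓ J

/-- Within a subproblem, edges of equal rank have distinct `true` ends. They form stars around
`false` ends, and each star can be colored by its center alone. -/
noncomputable def edgeRank (i : ℕ) (e : LEdge) : ℕ :=
  rank ((small ℓ J E i).filter fun f =>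
    node (level ℓ J E i).key true f = node (level ℓ J E i).key true e) e

/-- The edges colored together. -/
noncomputable def colorClass (i r : ℕ) : Finset LEdge :=
  (small ℓ J E i).filter fun e => edgeRank ℓ J E i e = r

/-- The colors in the list of `e` not used by adjacent edges. -/
noncomputable def avail (i : ℕ) (col : LEdge → Option ℕ) (e : LEdge) : Finset ℕ :=
  ((level ℓ J E i).list e).filter fun c => ∀ f ∈ E.filter (Adjacent e), col f ≠ some c

noncomputable def colorStep (i r : ℕ) (col : LEdge → Option ℕ) (e : LEdge) : Option ℕ :=
  if e ∈ colorClass ℓ J E i r then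
    some (representatives ((colorClass ℓ J E i r).filter fun f => f.right = e.right)
      (avail ℓ J E i col) e)
  else col e

/-- The partial coloring after `j` steps. -/
noncomputable def coloring : ℕ → LEdge → Option ℕ
  | 0 => fun _ => none
  -- The levels run backwards: everything colored before level `i` was left out at level `i` or
  -- later, hence is alive at level `i` and counted in the degrees there.
  | j + 1 => colorStep ℓ J E (ℓ - 1 - j / rankBound ℓ J) (j % rankBound ℓ J) (coloring j)

variable {ℓ J E}

theorem small_subset_alive {i : ℕ} : small ℓ J E i ⊆ (level ℓ J E i).alive := Finset.sdiff_subset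

theorem alive_subset {i : ℕ} : (level ℓ J E i).alive ⊆ E := level_alive_antitone (Nat.zero_le i)

theorem mem_alive_of_mem_small {i i' : ℕ} (h : i ≤ i') {e : LEdge} (he : e ∈ small ℓ J E i') :
    e ∈ (level ℓ J E i).alive := level_alive_antitone h (small_subset_alive he)

theorem eq_of_mem_small {i i' : ℕ} {e : LEdge} (he : e ∈ small ℓ J E i)
    (he' : e ∈ small ℓ J E i') : i = i' := by
  have key : ∀ i i', e ∈ small ℓ J E i → e ∈ small ℓ J E i' → ¬ i < i' := fun i i' h h' hlt =>
    (Finset.mem_sdiff.1 h).2 (level_alive_antitone hlt (small_subset_alive h'))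
  have h1 := key _ _ he he'
  have h2 := key _ _ he' he
  omega

/-- An edge is left out because its list is shorter than `2 * threshold`, and its degree at the
`true` end is at most the size of its list. -/
theorem edgeRank_lt (hE : Admissible ℓ J E) {i : ℕ} (hi : i < ℓ) {e : LEdge}
    (he : e ∈ small ℓ J E i) : edgeRank ℓ J E i e < rankBound ℓ J := by
  obtain ⟨h1, h2⟩ := Finset.mem_sdiff.1 he
  have hg := (level_good hE hi.le).nodeDeg_le e h1
  have h3 : edgeRank ℓ J E i e < nodeDeg (level ℓ J E i).alive (level ℓ J E i).key true e := by
    have hm : e ∈ (small ℓ J E i).filter fun f =>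
        node (level ℓ J E i).key true f = node (level ℓ J E i).key true e :=
      Finset.mem_filter.2 ⟨he, rfl⟩
    refine (rank_lt hm).trans_le (Finset.card_le_card fun f hf => ?_)
    obtain ⟨h4, h5⟩ := Finset.mem_filter.1 hf
    exact Finset.mem_filter.2 ⟨small_subset_alive h4, true, h5⟩
  have h4 : ((level ℓ J E i).list e).card < rankBound ℓ J := by
    have h5 : ¬ (threshold ℓ J * slackAt ℓ i ≤ ((level ℓ J E i).list e).card) := fun h =>
      h2 (Finset.mem_filter.2 ⟨h1, h⟩)
    have h6 := slackAt_le_two ℓ i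
    have h7 : (((level ℓ J E i).list e).card : ℝ) < rankBound ℓ J := by
      unfold rankBound
      push_cast
      nlinarith [(Nat.cast_nonneg (threshold ℓ J) : (0 : ℝ) ≤ threshold ℓ J)]
    exact_mod_cast h7
  have h5 : 0 < nodeDeg (level ℓ J E i).alive (level ℓ J E i).key false e := nodeDeg_pos h1
  omega

/-- The partial colorings that may occur before the edges in `colorClass i r` are colored. -/
structure GoodColoring (ℓ J : ℕ) (E : Finset LEdge) (j : ℕ) (col : LEdge → Option ℕ) : Prop where
  colored : ∀ e c, col e = some c → ∃ i r, i < ℓ ∧ r < rankBound ℓ J ∧ e ∈ colorClass ℓ J E i r ∧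
    (ℓ - 1 - i) * rankBound ℓ J + r < j ∧ c ∈ (level ℓ J E i).list e
  complete : ∀ i r e, i < ℓ → r < rankBound ℓ J → e ∈ colorClass ℓ J E i r →
    (ℓ - 1 - i) * rankBound ℓ J + r < j → col e ≠ none
  proper : ∀ e f c, e ≠ f → Adjacent e f → col e = some c → col f ≠ some c

variable {i r : ℕ} {col : LEdge → Option ℕ}

theorem GoodColoring.uncolored
    (h : GoodColoring ℓ J E ((ℓ - 1 - i) * rankBound ℓ J + r) col) {e : LEdge}
    (he : e ∈ colorClass ℓ J E i r) : col e = none := by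
  by_contra hne
  obtain ⟨c, hc⟩ := Option.ne_none_iff_exists'.1 hne
  obtain ⟨i', r', -, -, h3, h4, -⟩ := h.colored e c hc
  obtain rfl := eq_of_mem_small (Finset.mem_filter.1 he).1 (Finset.mem_filter.1 h3).1
  obtain rfl := (Finset.mem_filter.1 he).2.symm.trans (Finset.mem_filter.1 h3).2
  exact lt_irrefl _ h4

theorem GoodColoring.exists_representatives (hE : Admissible ℓ J E) (hi : i < ℓ)
    (hr : r < rankBound ℓ J) (h : GoodColoring ℓ J E ((ℓ - 1 - i) * rankBound ℓ J + r) col)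
    (x : ℕ) : ∃ f : LEdge → ℕ,
      (∀ e ∈ (colorClass ℓ J E i r).filter fun f => f.right = x, f e ∈ avail ℓ J E i col e) ∧
      Set.InjOn f ((colorClass ℓ J E i r).filter fun f => f.right = x) := by
  set s := level ℓ J E i with hs
  set S := (colorClass ℓ J E i r).filter fun f => f.right = x with hS
  have hg := level_good hE hi.le
  -- The colored edges `X` and the still uncolored competitors `Y` are disjoint inside the
  -- neighborhood of `e`. Since `e` lies in both `Z true` and `Z false`, `nodeDeg_le` gives `X.card
  -- + Y.card ≤ (s.list e).card`, while at most `X.card` colors are lost.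
  have main : ∀ e ∈ S, ∀ Y ⊆ S, (∀ f ∈ Y, s.key f = s.key e) → Y.card ≤ (avail ℓ J E i col e).card := by
    intro e he Y hY hYkey
    obtain ⟨he1, he2⟩ := Finset.mem_filter.1 he
    have he3 : e ∈ s.alive := small_subset_alive (Finset.mem_filter.1 he1).1
    set Z := fun b => s.alive.filter fun f => ∃ b', node s.key b' f = node s.key b e with hZ
    set X := (Z true ∪ Z false).filter fun f => col f ≠ none with hX
    have hXY : Disjoint X Y := by
      refine Finset.disjoint_left.2 fun f hf hf' => (Finset.mem_filter.1 hf).2 ?_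
      exact h.uncolored (Finset.mem_filter.1 (hY hf')).1
    have hXYZ : X ∪ Y ⊆ Z true ∪ Z false := by
      refine Finset.union_subset (Finset.filter_subset _ _) fun f hf => ?_
      obtain ⟨h1, h2⟩ := Finset.mem_filter.1 (hY hf)
      refine Finset.mem_union_right _ (Finset.mem_filter.2
        ⟨small_subset_alive (Finset.mem_filter.1 h1).1, false, ?_⟩)
      simp [node, h2, he2, hYkey f hf]
    have h1 : X.card + Y.card + 1 ≤ (Z true).card + (Z false).card := by
      rw [← Finset.card_union_of_disjoint hXY, ← Finset.card_union_add_card_inter]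
      refine add_le_add (Finset.card_le_card hXYZ) (Finset.card_pos.2 ⟨e, ?_⟩)
      simp only [hZ, Finset.mem_inter, Finset.mem_filter]
      exact ⟨⟨he3, _, rfl⟩, ⟨he3, _, rfl⟩⟩
    have h2 : (Z true).card + (Z false).card ≤ (s.list e).card + 1 := hg.nodeDeg_le e he3
    have h3 : s.list e ⊆ avail ℓ J E i col e ∪ X.image fun f => (col f).getD 0 := by
      intro c hc
      by_cases hav : ∀ f ∈ E.filter (Adjacent e), col f ≠ some c
      · exact Finset.mem_union_left _ (Finset.mem_filter.2 ⟨hc, hav⟩)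
      push Not at hav
      obtain ⟨f, hf, hfc⟩ := hav
      obtain ⟨i', r', h4, h5, h6, h7, h8⟩ := h.colored f c hfc
      have hii : i ≤ i' := by
        by_contra hlt
        have h9 : ℓ - 1 - i + 1 ≤ ℓ - 1 - i' := by omega
        have h10 := Nat.mul_le_mul_right (rankBound ℓ J) h9
        rw [add_mul, one_mul] at h10
        omega
      have hfa : f ∈ s.alive := mem_alive_of_mem_small hii (Finset.mem_filter.1 h6).1
      -- Only an edge of the same subproblem can take a color from the list of `e`.
      have hkey : s.key f = s.key e := by
        by_contra hne
        exact Finset.disjoint_left.1 (hg.disjoint f hfa e he3 hne)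
          (level_list_antitone f hii h8) hc
      refine Finset.mem_union_right _ (Finset.mem_image.2 ⟨f, Finset.mem_filter.2 ⟨?_, ?_⟩, ?_⟩)
      · rcases (Finset.mem_filter.1 hf).2 with hl | hl
        · exact Finset.mem_union_left _ (Finset.mem_filter.2 ⟨hfa, true, by simp [node, hl, hkey]⟩)
        · exact Finset.mem_union_right _
            (Finset.mem_filter.2 ⟨hfa, false, by simp [node, hl, hkey]⟩)
      · simp [hfc]
      · simp [hfc]
    have h4 := (Finset.card_le_card h3).trans (Finset.card_union_le _ _)
    have h5 : (X.image fun f => (col f).getD 0).card ≤ X.card := Finset.card_image_le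
    omega
  refine DistributedColoring.exists_representatives S _ (fun e he => ?_) fun e he => ?_
  · refine main e he _ (Finset.filter_subset _ _) fun f hf => ?_
    obtain ⟨hf1, hf2⟩ := Finset.mem_filter.1 hf
    by_contra hne
    have h1 : ∀ g ∈ S, g ∈ s.alive := fun g hg' =>
      small_subset_alive (Finset.mem_filter.1 (Finset.mem_filter.1 hg').1).1
    exact hf2 ((hg.disjoint e (h1 e he) f (h1 f hf1) (Ne.symm hne)).mono (Finset.filter_subset _ _)
      (Finset.filter_subset _ _))
  · have := main e he {e} (by simpa using he) (by simp)
    rw [Finset.card_singleton] at this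
    exact Finset.card_pos.1 this

theorem GoodColoring.step (hE : Admissible ℓ J E) (hi : i < ℓ) (hr : r < rankBound ℓ J)
    (h : GoodColoring ℓ J E ((ℓ - 1 - i) * rankBound ℓ J + r) col) :
    GoodColoring ℓ J E ((ℓ - 1 - i) * rankBound ℓ J + r + 1) (colorStep ℓ J E i r col) := by
  have hrep := fun x => representatives_spec (h.exists_representatives hE hi hr x)
  have hg := level_good hE hi.le
  have hnew : ∀ e ∈ colorClass ℓ J E i r, ∀ c, colorStep ℓ J E i r col e = some c →
      representatives ((colorClass ℓ J E i r).filter fun f => f.right = e.right)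
        (avail ℓ J E i col) e = c ∧ c ∈ avail ℓ J E i col e := by
    intro e he c hc
    rw [colorStep, if_pos he, Option.some.injEq] at hc
    exact ⟨hc, hc ▸ (hrep e.right).1 e (Finset.mem_filter.2 ⟨he, rfl⟩)⟩
  have hold : ∀ e ∉ colorClass ℓ J E i r, colorStep ℓ J E i r col e = col e :=
    fun e he => if_neg he
  have hclassE : ∀ e ∈ colorClass ℓ J E i r, e ∈ (level ℓ J E i).alive := fun e he =>
    small_subset_alive (Finset.mem_filter.1 he).1
  have hcolE : ∀ e c, col e = some c → e ∈ E := fun e c hc => by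
    obtain ⟨i', r', -, -, h3, -⟩ := h.colored e c hc
    exact alive_subset (small_subset_alive (Finset.mem_filter.1 h3).1)
  refine ⟨fun e c hc => ?_, fun i' r' e hi' hr' he hlt => ?_, fun e f c hne hadj hc hc' => ?_⟩
  · by_cases he : e ∈ colorClass ℓ J E i r
    · exact ⟨i, r, hi, hr, he, Nat.lt_succ_self _, (Finset.mem_filter.1 (hnew e he c hc).2).1⟩
    · rw [hold e he] at hc
      obtain ⟨i', r', h1, h2, h3, h4, h5⟩ := h.colored e c hc
      exact ⟨i', r', h1, h2, h3, by omega, h5⟩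
  · by_cases hec : e ∈ colorClass ℓ J E i r
    · rw [colorStep, if_pos hec]; simp
    · rw [hold e hec]
      refine h.complete i' r' e hi' hr' he (lt_of_le_of_ne (Nat.lt_succ_iff.1 hlt) fun heq => hec ?_)
      -- The position in the order determines the level and the rank by division with remainder.
      have hR : 0 < rankBound ℓ J := by omega
      have h1 : ℓ - 1 - i' = ℓ - 1 - i := by
        have := congrArg (· / rankBound ℓ J) heq
        simpa [mul_comm _ (rankBound ℓ J), Nat.mul_add_div hR, Nat.div_eq_of_lt hr,
          Nat.div_eq_of_lt hr'] using this
      have h2 : i' = i := by omega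
      subst h2
      have h3 : r' = r := by omega
      exact h3 ▸ he
  · have hadj' : Adjacent f e := hadj.imp Eq.symm Eq.symm
    by_cases he : e ∈ colorClass ℓ J E i r
    · obtain ⟨h1, h2⟩ := hnew e he c hc
      by_cases hf : f ∈ colorClass ℓ J E i r
      · obtain ⟨h3, h4⟩ := hnew f hf c hc'
        by_cases hright : f.right = e.right
        · rw [hright] at h3
          exact hne ((hrep e.right).2 (Finset.mem_coe.2 (Finset.mem_filter.2 ⟨he, rfl⟩))
            (Finset.mem_coe.2 (Finset.mem_filter.2 ⟨hf, hright⟩)) (h1.trans h3.symm))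
        -- Two edges of one class at a common `true` end: an equal color forces equal keys, and
        -- equal ranks then force equal edges.
        · have hleft : f.left = e.left := hadj.resolve_right hright
          have hkey : (level ℓ J E i).key e = (level ℓ J E i).key f := by
            by_contra hk
            exact Finset.disjoint_left.1 (hg.disjoint e (hclassE e he) f (hclassE f hf) hk)
              (Finset.mem_filter.1 h2).1 (Finset.mem_filter.1 h4).1
          have hnode : node (level ℓ J E i).key true f = node (level ℓ J E i).key true e := by
            simp [node, hleft, hkey]
          obtain ⟨he1, he2⟩ := Finset.mem_filter.1 he
          obtain ⟨hf1, hf2⟩ := Finset.mem_filter.1 hf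
          rw [← hf2, edgeRank, edgeRank, hnode] at he2
          have hm : e ∈ (small ℓ J E i).filter fun f =>
              node (level ℓ J E i).key true f = node (level ℓ J E i).key true e :=
            Finset.mem_filter.2 ⟨he1, rfl⟩
          exact hne (rank_injOn _ hm (Finset.mem_coe.2 (Finset.mem_filter.2 ⟨hf1, hnode⟩)) he2)
      · rw [hold f hf] at hc'
        exact (Finset.mem_filter.1 h2).2 f (Finset.mem_filter.2 ⟨hcolE f c hc', hadj⟩) hc'
    · rw [hold e he] at hc
      by_cases hf : f ∈ colorClass ℓ J E i r
      · obtain ⟨-, h4⟩ := hnew f hf c hc'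
        exact (Finset.mem_filter.1 h4).2 e (Finset.mem_filter.2 ⟨hcolE e c hc, hadj'⟩) hc
      · rw [hold f hf] at hc'
        exact h.proper e f c hne hadj hc hc'

theorem rankBound_pos (hℓ : 0 < ℓ) : 0 < rankBound ℓ J := by
  unfold rankBound threshold gameSteps phases; positivity

theorem goodColoring (hℓ : 0 < ℓ) (hE : Admissible ℓ J E) {j : ℕ} (hj : j ≤ ℓ * rankBound ℓ J) :
    GoodColoring ℓ J E j (coloring ℓ J E j) := by
  have hR := rankBound_pos (J := J) hℓ
  induction j with
  | zero => exact ⟨fun _ _ h => by simp [coloring] at h, fun _ _ _ _ _ _ h => by simp at h,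
      fun _ _ _ _ _ h => by simp [coloring] at h⟩
  | succ j ih =>
    have hlt : j / rankBound ℓ J < ℓ := Nat.div_lt_of_lt_mul (by rw [mul_comm]; omega)
    have hsub : ℓ - 1 - (ℓ - 1 - j / rankBound ℓ J) = j / rankBound ℓ J := by
      generalize j / rankBound ℓ J = q at hlt ⊢; omega
    have heq : (ℓ - 1 - (ℓ - 1 - j / rankBound ℓ J)) * rankBound ℓ J + j % rankBound ℓ J = j := by
      rw [hsub, mul_comm]; exact Nat.div_add_mod _ _
    have h1 := ih (by omega)
    rw [← heq] at h1
    have h2 := h1.step hE (i := ℓ - 1 - j / rankBound ℓ J)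
      (by generalize j / rankBound ℓ J = q; omega) (Nat.mod_lt _ hR)
    rw [heq] at h2
    exact h2

/-- The color of `e` in the final coloring. -/
noncomputable def finalColor (ℓ J : ℕ) (E : Finset LEdge) (e : LEdge) : ℕ :=
  (coloring ℓ J E (ℓ * rankBound ℓ J) e).getD 0

theorem coloring_eq_finalColor (hℓ : 0 < ℓ) (hE : Admissible ℓ J E) {e : LEdge} (he : e ∈ E) :
    coloring ℓ J E (ℓ * rankBound ℓ J) e = some (finalColor ℓ J E e) := by
  obtain ⟨i, hi, hs⟩ := exists_small hℓ hE he
  have hr := edgeRank_lt hE hi hs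
  have hne := (goodColoring hℓ hE le_rfl).complete i _ e hi hr (Finset.mem_filter.2 ⟨hs, rfl⟩) (by
    have h1 : ℓ - 1 - i + 1 ≤ ℓ := by omega
    have h2 := Nat.mul_le_mul_right (rankBound ℓ J) h1
    rw [add_mul, one_mul] at h2
    omega)
  obtain ⟨c, hc⟩ := Option.ne_none_iff_exists'.1 hne
  simp [finalColor, hc]

theorem finalColor_mem (hℓ : 0 < ℓ) (hE : Admissible ℓ J E) {e : LEdge} (he : e ∈ E) :
    finalColor ℓ J E e ∈ e.colors := by
  obtain ⟨i, -, -, -, -, -, h⟩ :=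
    (goodColoring hℓ hE le_rfl).colored e _ (coloring_eq_finalColor hℓ hE he)
  exact level_list_antitone e (Nat.zero_le i) h

theorem finalColor_ne (hℓ : 0 < ℓ) (hE : Admissible ℓ J E) {e f : LEdge} (he : e ∈ E)
    (hf : f ∈ E) (hne : e ≠ f) (hadj : Adjacent e f) :
    finalColor ℓ J E e ≠ finalColor ℓ J E f := fun h =>
  (goodColoring hℓ hE le_rfl).proper e f _ hne hadj (coloring_eq_finalColor hℓ hE he)
    (h ▸ coloring_eq_finalColor hℓ hE hf)

end Greedy

end DistributedColoring

namespace DistributedColoring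

open scoped Classical

/-! ### Locality of the algorithm -/

/-- Yields equality of the sets themselves, so that the unspecified choices in `take`, `rank` and
`representatives` coincide in the two instances. -/
theorem filter_congr_of_nbhd {E E' : Finset LEdge} {e : LEdge} (h : nbhd E e = nbhd E' e)
    {A A' : Finset LEdge} (hA : A ⊆ E) (hA' : A' ⊆ E')
    {P P' : LEdge → Prop} [DecidablePred P] [DecidablePred P'] (hP : ∀ a, P a → Adjacent e a) (hP' : ∀ a, P' a → Adjacent e a)
    (hPP : ∀ a ∈ nbhd E e, (a ∈ A ∧ P a ↔ a ∈ A' ∧ P' a)) : A.filter P = A'.filter P' := by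
  ext a
  simp only [Finset.mem_filter]
  constructor
  · intro ha
    exact (hPP a (Finset.mem_filter.2 ⟨hA ha.1, hP a ha.2⟩)).1 ha
  · intro ha
    exact (hPP a (h ▸ Finset.mem_filter.2 ⟨hA' ha.1, hP' a ha.2⟩)).2 ha

theorem adjacent_of_node_eq {key : LEdge → ℕ} {b b' : Bool} {e f : LEdge}
    (h : node key b' f = node key b e) : Adjacent e f := by
  simp only [node, Node.mk.injEq] at h
  obtain ⟨rfl, h, -⟩ := h
  cases b'
  · exact Or.inr h
  · exact Or.inl h

theorem node_eq_congr {key key' : LEdge → ℕ} {e f : LEdge} (he : key e = key' e)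
    (hf : key f = key' f) (b b' : Bool) :
    node key b' f = node key b e ↔ node key' b' f = node key' b e := by
  simp only [node, he, hf]

/-! ### Locality of the token dropping game -/

section GameLocality

variable {g : Finset LEdge → TokenGame LEdge Node} {key : Finset LEdge → LEdge → ℕ}
  {side : Finset LEdge → LEdge → Bool} {δ t : ℕ}

/-- Data of a node are read through an incident edge `e` as data of `node key b e`, so locality
remains a property of functions on edges. -/
theorem offers_local (hsrc : ∀ E e, (g E).src e = node (key E) (side E e) e)
    (hdst : ∀ E e, (g E).dst e = node (key E) (!side E e) e) (hrate : ∀ E, (g E).rate = δ)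
    (harcs : ∀ E, (g E).arcs ⊆ E) {s : Finset LEdge → TokenState LEdge Node}
    (h : IsLocal t fun E e => (e ∈ (g E).arcs, key E e, side E e,
      (fun b => (g E).cap (node (key E) b e)), e ∈ (s E).used,
      fun b => (s E).active (node (key E) b e))) :
    IsLocal (t + 1) fun E e => e ∈ (g E).offers (s E) := by
  refine h.step fun E E' e hN hnb hself => propext ?_
  simp only [Prod.mk.injEq] at hnb hself
  obtain ⟨e1, e2, e3, e4, e5, e6⟩ := hself
  have hbusy : ∀ a, (fun b => (g E).cap (node (key E) b a)) =
      (fun b => (g E').cap (node (key E') b a)) →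
      (fun b => (s E).active (node (key E) b a)) =
      (fun b => (s E').active (node (key E') b a)) →
      ∀ b, (g E).Busy (s E) (node (key E) b a) ↔ (g E').Busy (s E') (node (key E') b a) := by
    intro a h1 h2 b
    unfold TokenGame.Busy
    rw [congrFun h1 b, congrFun h2 b, hrate, hrate]
  have hcand : (g E).candidates (s E) ((g E).src e) = (g E').candidates (s E') ((g E').src e) := by
    refine filter_congr_of_nbhd hN (harcs E) (harcs E') ?_ ?_ fun a ha => ?_
    · rintro a ⟨-, h, -⟩
      rw [hsrc, hsrc] at h
      exact adjacent_of_node_eq h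
    · rintro a ⟨-, h, -⟩
      rw [hsrc, hsrc] at h
      exact adjacent_of_node_eq h
    · obtain ⟨a1, a2, a3, a4, a5, a6⟩ := hnb a ha
      rw [hsrc, hsrc, hsrc, hsrc, hdst, hdst, a1, a5, e3, a3, node_eq_congr e2 a2,
        hbusy a a4 a6]
  have hcap : (g E).cap ((g E).src e) = (g E').cap ((g E').src e) := by
    rw [hsrc, hsrc, e3]; exact congrFun e4 _
  unfold TokenGame.offers
  rw [Finset.mem_filter, Finset.mem_filter, hcand, hcap, e1, hsrc, hsrc, e3, hbusy e e4 e6]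

theorem accepted_local
    (hdst : ∀ E e, (g E).dst e = node (key E) (!side E e) e)
    (harcs : ∀ E, (g E).arcs ⊆ E) {s : Finset LEdge → TokenState LEdge Node}
    (h : IsLocal t fun E e => (e ∈ (g E).arcs, key E e, side E e,
      (fun b => (g E).cap (node (key E) b e)), e ∈ (g E).offers (s E))) :
    IsLocal (t + 1) fun E e => e ∈ (g E).accepted (s E) := by
  refine h.step fun E E' e hN hnb hself => propext ?_
  simp only [Prod.mk.injEq] at hnb hself
  obtain ⟨e1, e2, e3, e4, e5⟩ := hself
  have hsub : ∀ E, (g E).offers (s E) ⊆ E := fun E => (Finset.filter_subset _ _).trans (harcs E)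
  have hin : ((g E).offers (s E)).filter (fun f => (g E).dst f = (g E).dst e) =
      ((g E').offers (s E')).filter (fun f => (g E').dst f = (g E').dst e) := by
    refine filter_congr_of_nbhd hN (hsub E) (hsub E') ?_ ?_ fun a ha => ?_
    · intro a h
      rw [hdst, hdst] at h
      exact adjacent_of_node_eq h
    · intro a h
      rw [hdst, hdst] at h
      exact adjacent_of_node_eq h
    · obtain ⟨a1, a2, a3, a4, a5⟩ := hnb a ha
      rw [hdst, hdst, hdst, hdst, a5, e3, a3, node_eq_congr e2 a2]
  have hcap : (g E).cap ((g E).dst e) = (g E').cap ((g E').dst e) := by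
    rw [hdst, hdst, e3]; exact congrFun e4 _
  unfold TokenGame.accepted
  rw [Finset.mem_filter, Finset.mem_filter, hin, hcap, e1, e5]

theorem next_local (hsrc : ∀ E e, (g E).src e = node (key E) (side E e) e)
    (hdst : ∀ E e, (g E).dst e = node (key E) (!side E e) e) (hrate : ∀ E, (g E).rate = δ)
    (harcs : ∀ E, (g E).arcs ⊆ E) {s : Finset LEdge → TokenState LEdge Node}
    (h : IsLocal t fun E e => (key E e, side E e,
      (fun b => (g E).cap (node (key E) b e)), e ∈ (s E).used,
      (fun b => (s E).active (node (key E) b e)), e ∈ (g E).accepted (s E))) :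
    IsLocal (t + 1) fun E e => (e ∈ ((g E).next (s E)).used,
      fun b => ((g E).next (s E)).active (node (key E) b e)) := by
  refine h.step fun E E' e hN hnb hself => ?_
  simp only [Prod.mk.injEq] at hnb hself ⊢
  obtain ⟨e2, e3, e4, e5, e6, e7⟩ := hself
  have hsub : ∀ E, (g E).accepted (s E) ⊆ E := fun E =>
    (Finset.filter_subset _ _).trans (harcs E)
  constructor
  · simp only [TokenGame.next, Finset.mem_union, e5, e7]
  · funext b
    have hbusy : (g E).Busy (s E) (node (key E) b e) ↔
        (g E').Busy (s E') (node (key E') b e) := by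
      unfold TokenGame.Busy
      rw [congrFun e4 b, congrFun e6 b, hrate, hrate]
    have h1 : ((g E).accepted (s E)).filter (fun f => (g E).src f = node (key E) b e) =
        ((g E').accepted (s E')).filter (fun f => (g E').src f = node (key E') b e) := by
      refine filter_congr_of_nbhd hN (hsub E) (hsub E') ?_ ?_ fun a ha => ?_
      · intro a h
        rw [hsrc] at h
        exact adjacent_of_node_eq h
      · intro a h
        rw [hsrc] at h
        exact adjacent_of_node_eq h
      · obtain ⟨a2, a3, -, -, -, a7⟩ := hnb a ha
        rw [hsrc, hsrc, a7, a3, node_eq_congr e2 a2]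
    have h2 : ((g E).accepted (s E)).filter (fun f => (g E).dst f = node (key E) b e) =
        ((g E').accepted (s E')).filter (fun f => (g E').dst f = node (key E') b e) := by
      refine filter_congr_of_nbhd hN (hsub E) (hsub E') ?_ ?_ fun a ha => ?_
      · intro a h
        rw [hdst] at h
        exact adjacent_of_node_eq h
      · intro a h
        rw [hdst] at h
        exact adjacent_of_node_eq h
      · obtain ⟨a2, a3, -, -, -, a7⟩ := hnb a ha
        rw [hdst, hdst, a7, a3, node_eq_congr e2 a2]
    simp only [TokenGame.next, h1, h2, hbusy, hrate, congrFun e6 b]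

/-- Each phase costs three units of distance: offers, acceptances, and the update of the token
counts. -/
theorem run_local (hsrc : ∀ E e, (g E).src e = node (key E) (side E e) e)
    (hdst : ∀ E e, (g E).dst e = node (key E) (!side E e) e) (hrate : ∀ E, (g E).rate = δ)
    (harcs : ∀ E, (g E).arcs ⊆ E)
    (h : IsLocal t fun E e => (e ∈ (g E).arcs, key E e, side E e,
      (fun b => (g E).cap (node (key E) b e)), fun b => (g E).tokens (node (key E) b e))) (k : ℕ) :
    IsLocal (t + 3 * k) fun E e => (e ∈ ((g E).run k).used,
      fun b => ((g E).run k).active (node (key E) b e)) := by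
  induction k with
  | zero =>
    exact (h.map fun x => (False, x.2.2.2.2)).congr fun E e => by simp [TokenGame.run]
  | succ k ih =>
    have h0 : IsLocal (t + 3 * k) fun E e => (e ∈ (g E).arcs, key E e, side E e,
        (fun b => (g E).cap (node (key E) b e)), e ∈ ((g E).run k).used,
        fun b => ((g E).run k).active (node (key E) b e)) :=
      (h.mono (Nat.le_add_right _ _)).map₂ ih
        fun x y => (x.1, x.2.1, x.2.2.1, x.2.2.2.1, y.1, y.2)
    have h1 := offers_local hsrc hdst hrate harcs h0
    have h2 := accepted_local hdst harcs ((h0.mono (Nat.le_add_right _ 1)).map₂ h1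
      fun x y => (x.1, x.2.1, x.2.2.1, x.2.2.2.1, y))
    exact next_local hsrc hdst hrate harcs ((h0.mono (Nat.le_add_right _ 2)).map₂ h2
      fun x y => (x.2.1, x.2.2.1, x.2.2.2.1, x.2.2.2.2.1, x.2.2.2.2.2, y))

end GameLocality

/-! ### Locality of the balanced orientation -/

section OrientationLocality

variable {A : Finset LEdge → Finset LEdge} {key : Finset LEdge → LEdge → ℕ}
  {target weight : Finset LEdge → LEdge → ℝ} {ℓ J t : ℕ}

/-- A balancing problem for every instance. -/
noncomputable abbrev problem (A : Finset LEdge → Finset LEdge) (key : Finset LEdge → LEdge → ℕ)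
    (target weight : Finset LEdge → LEdge → ℝ) (ℓ J : ℕ) (E : Finset LEdge) :
    Balancing LEdge Node := Balancing.standard ℓ J (A E) (node (key E)) (target E) (weight E)

theorem nodeDeg_local (hA : ∀ E, A E ⊆ E) (h : IsLocal t fun E e => (e ∈ A E, key E e)) :
    IsLocal (t + 1) fun E e b => nodeDeg (A E) (key E) b e := by
  refine h.step fun E E' e hN hnb hself => ?_
  simp only [Prod.mk.injEq] at hnb hself
  funext b
  refine congrArg Finset.card (filter_congr_of_nbhd hN (hA E) (hA E') ?_ ?_ fun a ha => ?_)
  · rintro a ⟨b', h⟩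
    exact adjacent_of_node_eq h
  · rintro a ⟨b', h⟩
    exact adjacent_of_node_eq h
  · obtain ⟨a1, a2⟩ := hnb a ha
    simp only [a1, node_eq_congr hself.2 a2]

theorem load_local (hA : ∀ E, A E ⊆ E) {dir : Finset LEdge → LEdge → Option Bool}
    (h : IsLocal t fun E e => (e ∈ A E, key E e, dir E e)) :
    IsLocal (t + 1) fun E e b =>
      (problem A key target weight ℓ J E).load (dir E) (node (key E) b e) := by
  refine h.step fun E E' e hN hnb hself => ?_
  simp only [Prod.mk.injEq] at hnb hself
  funext b
  refine congrArg Finset.card (filter_congr_of_nbhd hN (hA E) (hA E') ?_ ?_ fun a ha => ?_)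
  · rintro a ⟨b', -, h⟩
    exact adjacent_of_node_eq h
  · rintro a ⟨b', -, h⟩
    exact adjacent_of_node_eq h
  · obtain ⟨a1, a2, a3⟩ := hnb a ha
    change (a ∈ A E ∧ ∃ b', dir E a = some b' ∧ node (key E) b' a = node (key E) b e) ↔
      (a ∈ A E' ∧ ∃ b', dir E' a = some b' ∧ node (key E') b' a = node (key E') b e)
    simp only [a1, a3, node_eq_congr hself.2.1 a2]

theorem excess_local (hA : ∀ E, A E ⊆ E) {dir : Finset LEdge → LEdge → Option Bool}
    (h : IsLocal t fun E e => (e ∈ A E, key E e, target E e, dir E e)) :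
    IsLocal (t + 1) fun E e b => (problem A key target weight ℓ J E).excess (dir E) b e := by
  have h1 := load_local (target := target) (weight := weight) (ℓ := ℓ) (J := J) hA
    (h.map fun x => (x.1, x.2.1, x.2.2.2))
  exact h1.map₂ (h.mono (Nat.le_succ t)) fun (x : Bool → ℕ) y b =>
    (x b : ℝ) - x (!b) - Balancing.sgn b * y.2.2.1

theorem inserted_local (hA : ∀ E, A E ⊆ E) {dir : Finset LEdge → LEdge → Option Bool} {δ : ℕ}
    (h : IsLocal t fun E e => (e ∈ A E, key E e, weight E e, dir E e,
      (problem A key target weight ℓ J E).pref (dir E) e)) :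
    IsLocal (t + 1) fun E e => e ∈ (problem A key target weight ℓ J E).inserted (dir E) δ := by
  refine h.step fun E E' e hN hnb hself => propext ?_
  simp only [Prod.mk.injEq] at hnb hself
  obtain ⟨e1, e2, e3, e4, e5⟩ := hself
  have hprop : (problem A key target weight ℓ J E).proposals (dir E) δ
        (node (key E) ((problem A key target weight ℓ J E).pref (dir E) e) e) =
      (problem A key target weight ℓ J E').proposals (dir E') δ
        (node (key E') ((problem A key target weight ℓ J E').pref (dir E') e) e) := by
    refine filter_congr_of_nbhd hN (hA E) (hA E') ?_ ?_ fun a ha => ?_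
    · rintro a ⟨-, -, h⟩
      exact adjacent_of_node_eq h
    · rintro a ⟨-, -, h⟩
      exact adjacent_of_node_eq h
    · obtain ⟨a1, a2, a3, a4, a5⟩ := hnb a ha
      change (a ∈ A E ∧ dir E a = none ∧ (threshold ℓ J * δ : ℝ) ≤ weight E a ∧
          node (key E) _ a = node (key E) _ e) ↔
        (a ∈ A E' ∧ dir E' a = none ∧ (threshold ℓ J * δ : ℝ) ≤ weight E' a ∧
          node (key E') _ a = node (key E') _ e)
      rw [a1, a3, a4, a5, e5, node_eq_congr e2 a2]
  change e ∈ (A E).filter _ ↔ e ∈ (A E').filter _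
  rw [Finset.mem_filter, Finset.mem_filter, e1]
  change _ ∧ e ∈ take ((problem A key target weight ℓ J E).proposals (dir E) δ
        (node (key E) ((problem A key target weight ℓ J E).pref (dir E) e) e))
          (gameSteps ℓ J * δ) ↔ _
  rw [hprop]
  rfl

theorem tokens_local (hA : ∀ E, A E ⊆ E) {dir : Finset LEdge → LEdge → Option Bool} {δ : ℕ}
    (h : IsLocal t fun E e => (key E e, (problem A key target weight ℓ J E).pref (dir E) e,
      e ∈ (problem A key target weight ℓ J E).inserted (dir E) δ)) :
    IsLocal (t + 1) fun E e b =>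
      ((problem A key target weight ℓ J E).game (dir E) δ).tokens (node (key E) b e) := by
  refine h.step fun E E' e hN hnb hself => ?_
  simp only [Prod.mk.injEq] at hnb hself
  obtain ⟨e1, e2, e3⟩ := hself
  funext b
  refine congrArg Finset.card (filter_congr_of_nbhd hN ((Finset.filter_subset _ _).trans (hA E))
    ((Finset.filter_subset _ _).trans (hA E')) ?_ ?_ fun a ha => ?_)
  · intro a h
    exact adjacent_of_node_eq h
  · intro a h
    exact adjacent_of_node_eq h
  · obtain ⟨a1, a2, a3⟩ := hnb a ha
    change a ∈ (problem A key target weight ℓ J E).inserted (dir E) δ ∧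
        node (key E) _ a = node (key E) b e ↔
      a ∈ (problem A key target weight ℓ J E').inserted (dir E') δ ∧
        node (key E') _ a = node (key E') b e
    rw [a2, a3, node_eq_congr e1 a1]

/-- The number of communication rounds of one orientation phase. -/
def phaseRounds (ℓ J : ℕ) : ℕ := 3 * gameSteps ℓ J + 3

/-- The three units beyond the game are for the loads behind the preferences, for the proposals, and
for the initial token counts. -/
theorem phase_local (hA : ∀ E, A E ⊆ E) {dir : Finset LEdge → LEdge → Option Bool} {δ : ℕ}
    (h : IsLocal t fun E e => (e ∈ A E, key E e, target E e, weight E e, dir E e,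
      fun b => (problem A key target weight ℓ J E).cap (node (key E) b e))) :
    IsLocal (t + phaseRounds ℓ J) fun E e =>
      (problem A key target weight ℓ J E).phase (dir E) δ e := by
  have hex : IsLocal (t + 1) fun E e b =>
      (problem A key target weight ℓ J E).excess (dir E) b e := excess_local (weight := weight) (ℓ := ℓ) (J := J) hA
    (h.map fun x => (x.1, x.2.1, x.2.2.1, x.2.2.2.2.1))
  have h1 := h.mono (Nat.le_succ t)
  have hpref : IsLocal (t + 1) fun E e => (problem A key target weight ℓ J E).pref (dir E) e :=
    hex.map fun x => decide (x true ≤ 0)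
  have hins := inserted_local (δ := δ) hA (h1.map₂ hpref fun x y =>
    (x.1, x.2.1, x.2.2.2.1, x.2.2.2.2.1, y))
  have htok := tokens_local hA ((h1.mono (Nat.le_succ _)).map₂
    ((hpref.mono (Nat.le_succ _)).prod hins) fun x y => (x.2.1, y.1, y.2))
  have hgame : IsLocal (t + 3) fun E e =>
      (e ∈ ((problem A key target weight ℓ J E).game (dir E) δ).arcs, key E e,
        (dir E e).getD true,
        (fun b => ((problem A key target weight ℓ J E).game (dir E) δ).cap (node (key E) b e)),
        fun b => ((problem A key target weight ℓ J E).game (dir E) δ).tokens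
          (node (key E) b e)) := by
    have harc : IsLocal (t + 3) fun E e =>
        (e ∈ ((problem A key target weight ℓ J E).game (dir E) δ).arcs) := by
      refine ((h1.map₂ hex fun x y => (x.1 ∧ ∃ b, x.2.2.2.2.1 = some b ∧ 0 < y b)).mono
        (Nat.le_add_right (t + 1) 2)).congr fun E e => ?_
      exact (propext (Balancing.mem_arcs (problem A key target weight ℓ J E) (dir E) δ (e := e))).symm
    exact harc.map₂ (((h1.mono (Nat.le_add_right _ 2))).prod htok) fun x y =>
      (x, y.1.2.1, (y.1.2.2.2.2.1).getD true, y.1.2.2.2.2.2, y.2)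
  have hrun := run_local (g := fun E => (problem A key target weight ℓ J E).game (dir E) δ)
    (key := key) (side := fun E e => (dir E e).getD true) (δ := δ) (fun _ _ => rfl)
    (fun _ _ => rfl) (fun _ => rfl) (fun E => (Finset.filter_subset _ _).trans (hA E)) hgame
    (gameSteps ℓ J)
  have hle : t + 3 + 3 * gameSteps ℓ J = t + phaseRounds ℓ J := by unfold phaseRounds; omega
  rw [hle] at hrun
  have hmono : t + 2 ≤ t + phaseRounds ℓ J := by unfold phaseRounds; omega
  have hall := ((h.mono (Nat.le_add_right _ (phaseRounds ℓ J))).prod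
    ((hpref.mono (by omega)).prod (hins.mono hmono))).prod hrun
  refine (hall.map fun x => if x.1.2.2 then some x.1.2.1 else if x.2.1 then
    (x.1.1.2.2.2.2.1).map (!·) else x.1.1.2.2.2.2.1).congr fun E e => ?_
  simp only [Balancing.phase]
  congr

theorem final_local (hA : ∀ E, A E ⊆ E)
    (h : IsLocal t fun E e => (e ∈ A E, key E e, target E e, weight E e)) :
    IsLocal (t + 1 + (J + 1) * phases ℓ * phaseRounds ℓ J) fun E e =>
      Balancing.final ℓ J (problem A key target weight ℓ J E) e := by
  have hcap : IsLocal (t + 1) fun E e b =>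
      (problem A key target weight ℓ J E).cap (node (key E) b e) :=
    (nodeDeg_local hA (h.map fun x => (x.1, x.2.1))).map fun x b => x b / capDivisor ℓ J + 1
  have key : ∀ i, IsLocal (t + 1 + i * phaseRounds ℓ J) fun E e =>
      (problem A key target weight ℓ J E).orient (Balancing.geomRate (phases ℓ) J) i e := by
    intro i
    induction i with
    | zero => exact IsLocal.static _
    | succ i ih =>
      have h1 := ((h.mono (by omega)).prod ((hcap.mono (by omega)).prod ih)).map
        fun x => (x.1.1, x.1.2.1, x.1.2.2.1, x.1.2.2.2, x.2.2, x.2.1)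
      have h2 := phase_local hA (δ := Balancing.geomRate (phases ℓ) J i) h1
      rw [add_mul, one_mul, ← add_assoc]
      exact h2
  exact key _

end OrientationLocality

/-! ### Locality of the levels and of the greedy coloring -/

section LevelLocality

variable {ℓ J t : ℕ}

/-- The number of communication rounds of one level. -/
def levelRounds (ℓ J : ℕ) : ℕ := 2 + (J + 1) * phases ℓ * phaseRounds ℓ J

theorem mem_big {i : ℕ} {s : LevelState} {e : LEdge} : e ∈ big ℓ J i s ↔
    e ∈ s.alive ∧ threshold ℓ J * slackAt ℓ i ≤ (s.list e).card := Finset.mem_filter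

theorem nextLevel_local {s : Finset LEdge → LevelState} (hs : ∀ E, (s E).alive ⊆ E) {i : ℕ}
    (h : IsLocal t fun E e => (e ∈ (s E).alive, (s E).key e, (s E).list e)) :
    IsLocal (t + levelRounds ℓ J) fun E e => (e ∈ (nextLevel ℓ J i (s E)).alive,
      (nextLevel ℓ J i (s E)).key e, (nextLevel ℓ J i (s E)).list e) := by
  have hbigE : ∀ E, big ℓ J i (s E) ⊆ E := fun E => (Finset.filter_subset _ _).trans (hs E)
  have hbig : IsLocal t fun E e => e ∈ big ℓ J i (s E) := by
    exact (h.map fun x => (x.1 ∧ (threshold ℓ J * slackAt ℓ i : ℝ) ≤ (x.2.2.card : ℝ))).congr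
      fun E e => (propext mem_big).symm
  have hdeg := nodeDeg_local hbigE (hbig.map₂ h fun x y => (x, y.2.1))
  have hbit := final_local (ℓ := ℓ) (J := J) (A := fun E => big ℓ J i (s E))
    (key := fun E => (s E).key) (target := fun E => levelTarget ℓ J i (s E))
    (weight := fun E => levelWeight ℓ i (s E)) hbigE (t := t + 1)
    (((h.mono (Nat.le_succ t)).prod ((hbig.mono (Nat.le_succ t)).prod hdeg)).map fun x =>
      (x.2.1, x.1.2.1, ((x.1.2.2.filter fun c => c.testBit i = true).card : ℝ) /
        slackAt ℓ (i + 1) - (x.1.2.2.card / slackAt ℓ i) / (4 * ℓ) - x.2.2 false,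
        (x.1.2.2.card / slackAt ℓ i : ℝ)))
  -- The two extra units are for the degree inside `levelTarget` and for the degrees that determine
  -- the quotas.
  have hle : t + 1 + 1 + (J + 1) * phases ℓ * phaseRounds ℓ J = t + levelRounds ℓ J := by
    unfold levelRounds; omega
  rw [hle] at hbit
  exact ((h.prod hbig).mono (Nat.le_add_right t (levelRounds ℓ J))).map₂ hbit fun x y =>
    (x.2, 2 * x.1.2.1 + (y == some true).toNat,
      x.1.2.2.filter fun c => c.testBit i = (y == some true))

theorem level_local (i : ℕ) :
    IsLocal (1 + i * levelRounds ℓ J) fun E e => (e ∈ (level ℓ J E i).alive,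
      (level ℓ J E i).key e, (level ℓ J E i).list e) := by
  induction i with
  | zero =>
    rw [zero_mul]
    exact IsLocal.mem.map₂ (IsLocal.static LEdge.colors) fun x y => (x, 0, y)
  | succ i ih =>
    rw [add_mul, one_mul, ← add_assoc]
    exact nextLevel_local (fun E => alive_subset) ih

theorem small_local {i : ℕ} (hi : i < ℓ) :
    IsLocal (1 + ℓ * levelRounds ℓ J) fun E e => (e ∈ small ℓ J E i,
      (level ℓ J E i).key e, (level ℓ J E i).list e) := by
  have h1 := (level_local (ℓ := ℓ) (J := J) i).mono
    (add_le_add_right (Nat.mul_le_mul_right (levelRounds ℓ J) hi.le) 1)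
  have h2 := (level_local (ℓ := ℓ) (J := J) (i + 1)).mono
    (add_le_add_right (Nat.mul_le_mul_right (levelRounds ℓ J) hi) 1)
  have h3 := h1.map₂ h2 fun x y => (x.1 ∧ ¬ y.1)
  have h4 : IsLocal (1 + ℓ * levelRounds ℓ J) fun E e => e ∈ small ℓ J E i :=
    h3.congr fun E e => (propext Finset.mem_sdiff).symm
  exact h4.map₂ h1 fun x y => (x, y.2.1, y.2.2)

theorem colorClass_local {i : ℕ} (hi : i < ℓ) (r : ℕ) :
    IsLocal (1 + ℓ * levelRounds ℓ J + 1) fun E e => e ∈ colorClass ℓ J E i r := by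
  refine (small_local hi).step fun E E' e hN hnb hself => propext ?_
  simp only [Prod.mk.injEq] at hnb hself
  obtain ⟨e1, e2, e3⟩ := hself
  have hsub : ∀ E, small ℓ J E i ⊆ E := fun E => small_subset_alive.trans alive_subset
  have hset : ((small ℓ J E i).filter fun f =>
      node (level ℓ J E i).key true f = node (level ℓ J E i).key true e) =
      (small ℓ J E' i).filter fun f =>
        node (level ℓ J E' i).key true f = node (level ℓ J E' i).key true e := by
    refine filter_congr_of_nbhd hN (hsub E) (hsub E') (fun _ => adjacent_of_node_eq)
      (fun _ => adjacent_of_node_eq) fun a ha => ?_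
    obtain ⟨a1, a2, a3⟩ := hnb a ha
    rw [a1, node_eq_congr e2 a2]
  unfold colorClass
  rw [Finset.mem_filter, Finset.mem_filter, e1, edgeRank, edgeRank, hset]

/-- One unit to see which colors adjacent edges use, and one more to see the available colors
throughout the star. -/
theorem colorStep_local {i : ℕ} (hi : i < ℓ) (r : ℕ) {col : Finset LEdge → LEdge → Option ℕ}
    (h : IsLocal (1 + ℓ * levelRounds ℓ J + 1 + t) col) :
    IsLocal (1 + ℓ * levelRounds ℓ J + 1 + t + 2) fun E => colorStep ℓ J E i r (col E) := by
  have hcls := (colorClass_local (J := J) hi r).mono (Nat.le_add_right _ t)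
  have hlst := (small_local (J := J) hi).mono (Nat.le_add_right _ (1 + t))
  rw [← add_assoc] at hlst
  have hav : IsLocal (1 + ℓ * levelRounds ℓ J + 1 + t + 1) fun E e =>
      avail ℓ J E i (col E) e := by
    refine (h.prod hlst).step fun E E' e hN hnb hself => ?_
    simp only [Prod.mk.injEq] at hnb hself
    unfold avail
    rw [hself.2.2.2]
    refine Finset.filter_congr fun c _ => ?_
    change (∀ f ∈ nbhd E e, _) ↔ ∀ f ∈ nbhd E' e, _
    rw [← hN]
    exact forall₂_congr fun f hf => by rw [(hnb f hf).1]
  have hall := ((h.prod hcls).mono (Nat.le_succ _)).prod hav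
  refine hall.step fun E E' e hN hnb hself => ?_
  simp only [Prod.mk.injEq] at hnb hself
  obtain ⟨⟨e1, e2⟩, e3⟩ := hself
  have hsub : ∀ E, colorClass ℓ J E i r ⊆ E := fun E =>
    (Finset.filter_subset _ _).trans (small_subset_alive.trans alive_subset)
  have hset : (colorClass ℓ J E i r).filter (fun f => f.right = e.right) =
      (colorClass ℓ J E' i r).filter fun f => f.right = e.right :=
    filter_congr_of_nbhd hN (hsub E) (hsub E') (fun _ => Or.inr) (fun _ => Or.inr) fun a ha => by
      rw [(hnb a ha).1.2]
  unfold colorStep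
  rw [hset, representatives_congr (B := avail ℓ J E' i (col E')) fun a ha => ?_]
  · simp only [e1, e2]
  · rw [← hset] at ha
    obtain ⟨h1, h2⟩ := Finset.mem_filter.1 ha
    exact (hnb a (Finset.mem_filter.2 ⟨hsub E h1, Or.inr h2⟩)).2

theorem coloring_local (hℓ : 0 < ℓ) (j : ℕ) :
    IsLocal (1 + ℓ * levelRounds ℓ J + 1 + 2 * j) fun E => coloring ℓ J E j := by
  induction j with
  | zero => exact IsLocal.static _
  | succ j ih =>
    exact colorStep_local (by generalize j / rankBound ℓ J = q; omega) _ ih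

/-- The distance up to which the color of an edge depends on the instance. -/
def localityRadius (ℓ J : ℕ) : ℕ := 1 + ℓ * levelRounds ℓ J + 1 + 2 * (ℓ * rankBound ℓ J)

theorem finalColor_local (hℓ : 0 < ℓ) : IsLocal (localityRadius ℓ J) (finalColor ℓ J) :=
  (coloring_local hℓ _).map fun x => x.getD 0

end LevelLocality

end DistributedColoring

namespace DistributedColoring

open LocalModel ListEdgeColoring
open scoped Classical

/-! ### Labelled edges of a bipartite graph -/

section Labels

variable {V : Type} [Fintype V] {G : SimpleGraph V} [DecidableRel G.Adj]
  (port : PortNumbering G) (ident : V → ℕ) (side : G.Coloring Bool) (L : G.edgeSet → Finset ℕ)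

omit [Fintype V] [DecidableRel G.Adj] in
theorem exists_ends (e : G.edgeSet) :
    ∃ x : V × V, side x.1 = true ∧ side x.2 = false ∧ e.1 = s(x.1, x.2) := by
  obtain ⟨e, he⟩ := e
  induction e using Sym2.ind with
  | _ v w =>
    have h := side.valid (G.mem_edgeSet.1 he)
    cases hv : side v <;> cases hw : side w <;> simp [hv, hw] at h
    · exact ⟨(w, v), hw, hv, Sym2.eq_swap⟩
    · exact ⟨(v, w), hv, hw, rfl⟩

/-- The endpoint of `e` on the side `true`. -/
noncomputable def trueEnd (e : G.edgeSet) : V := (exists_ends side e).choose.1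

/-- The endpoint of `e` on the side `false`. -/
noncomputable def falseEnd (e : G.edgeSet) : V := (exists_ends side e).choose.2

omit [Fintype V] [DecidableRel G.Adj] in
theorem side_trueEnd (e : G.edgeSet) : side (trueEnd side e) = true :=
  (exists_ends side e).choose_spec.1

omit [Fintype V] [DecidableRel G.Adj] in
theorem side_falseEnd (e : G.edgeSet) : side (falseEnd side e) = false :=
  (exists_ends side e).choose_spec.2.1

omit [Fintype V] [DecidableRel G.Adj] in
theorem edge_eq_ends (e : G.edgeSet) : e.1 = s(trueEnd side e, falseEnd side e) :=
  (exists_ends side e).choose_spec.2.2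

noncomputable def edgeLabel (e : G.edgeSet) : LEdge :=
  ⟨ident (trueEnd side e), ident (falseEnd side e), L e⟩

theorem portLabel_eq (v : V) (i : Fin (G.degree v)) :
    portLabel port ident side L v i = edgeLabel ident side L (portEdge port v i) := by
  set e := portEdge port v i with he
  have h1 : s(v, (port v i).1) = s(trueEnd side e, falseEnd side e) := edge_eq_ends side e
  have h2 := side_trueEnd side e
  have h3 := side_falseEnd side e
  rcases Sym2.eq_iff.1 h1 with ⟨h4, h5⟩ | ⟨h4, h5⟩
  · rw [← h4] at h2
    rw [portLabel, edgeLabel, ← he, ← h4, ← h5, mkEdge, h2, if_pos rfl]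
  · rw [← h4] at h3
    rw [portLabel, edgeLabel, ← he, ← h4, ← h5, mkEdge, h3, if_neg (by simp)]

theorem exists_portEdge_eq {e : G.edgeSet} {v : V} (hv : v ∈ e.1) :
    ∃ i, portEdge port v i = e := by
  obtain ⟨w, hw⟩ := Sym2.mem_iff_exists.1 hv
  have hadj : G.Adj v w := by rw [← G.mem_edgeSet, ← hw]; exact e.2
  refine ⟨port.portTo hadj, Subtype.ext ?_⟩
  simp [portEdge, PortNumbering.portTo, hw]

omit [Fintype V] [DecidableRel G.Adj] in
theorem mem_edge_iff {e : G.edgeSet} {v : V} :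
    v ∈ e.1 ↔ v = trueEnd side e ∨ v = falseEnd side e := by
  rw [edge_eq_ends side e, Sym2.mem_iff]

theorem mem_allEdges {x : LEdge} :
    x ∈ allEdges port ident side L ↔ ∃ e, edgeLabel ident side L e = x := by
  simp only [allEdges, Finset.mem_biUnion, Finset.mem_image, Finset.mem_univ, true_and]
  constructor
  · rintro ⟨v, i, rfl⟩
    exact ⟨_, (portLabel_eq port ident side L v i).symm⟩
  · rintro ⟨e, rfl⟩
    obtain ⟨i, hi⟩ := exists_portEdge_eq port ((mem_edge_iff side).2 (Or.inl rfl) : _ ∈ e.1)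
    exact ⟨_, i, by rw [portLabel_eq, hi]⟩

variable {ident} (hid : Function.Injective ident)

omit [Fintype V] [DecidableRel G.Adj] in
include hid in
theorem eq_of_ends {e f : G.edgeSet}
    (h1 : (edgeLabel ident side L e).left = (edgeLabel ident side L f).left)
    (h2 : (edgeLabel ident side L e).right = (edgeLabel ident side L f).right) : e = f := by
  have h3 : trueEnd side e = trueEnd side f := hid h1
  have h4 : falseEnd side e = falseEnd side f := hid h2
  exact Subtype.ext (by rw [edge_eq_ends side e, edge_eq_ends side f, h3, h4])

omit [Fintype V] [DecidableRel G.Adj] in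
include hid in
theorem lineGraph_adj_iff {e f : G.edgeSet} : G.lineGraph.Adj e f ↔
    e ≠ f ∧ Adjacent (edgeLabel ident side L e) (edgeLabel ident side L f) := by
  rw [SimpleGraph.lineGraph_adj_iff_exists]
  refine and_congr_right fun _ => ⟨?_, ?_⟩
  · rintro ⟨v, hv, hv'⟩
    have h1 := side_trueEnd side e
    have h2 := side_falseEnd side e
    have h3 := side_trueEnd side f
    have h4 := side_falseEnd side f
    rcases (mem_edge_iff side).1 hv with rfl | rfl <;>
      rcases (mem_edge_iff side).1 hv' with h | h
    · exact Or.inl (congrArg ident h.symm)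
    · rw [h, h4] at h1; simp at h1
    · rw [h, h3] at h2; simp at h2
    · exact Or.inr (congrArg ident h.symm)
  · rintro (h | h)
    · exact ⟨_, (mem_edge_iff side).2 (Or.inl rfl), (mem_edge_iff side).2 (Or.inl (hid h).symm)⟩
    · exact ⟨_, (mem_edge_iff side).2 (Or.inr rfl), (mem_edge_iff side).2 (Or.inr (hid h).symm)⟩

theorem node_zero_eq {b : Bool} {x y : LEdge} : node (fun _ => 0) b x = node (fun _ => 0) b y ↔
    (if b then x.left else x.right) = if b then y.left else y.right := by
  simp [node]

include hid in
-- The excess of 2 is `e` itself, counted once at each end.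
theorem nodeDeg_add_le (e : G.edgeSet) :
    nodeDeg (allEdges port ident side L) (fun _ => 0) true (edgeLabel ident side L e) +
      nodeDeg (allEdges port ident side L) (fun _ => 0) false (edgeLabel ident side L e) ≤
        edgeDegree G e + 2 := by
  unfold nodeDeg
  simp only [exists_node_eq, node_zero_eq, if_true, Bool.false_eq_true, if_false]
  rw [← Finset.card_union_add_card_inter]
  have h1 : (((allEdges port ident side L).filter
        fun f => f.left = (edgeLabel ident side L e).left) ∪
      ((allEdges port ident side L).filter
        fun f => f.right = (edgeLabel ident side L e).right)).card ≤ edgeDegree G e + 1 := by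
    have hsub : (((allEdges port ident side L).filter
        fun f => f.left = (edgeLabel ident side L e).left) ∪
      ((allEdges port ident side L).filter
        fun f => f.right = (edgeLabel ident side L e).right)) ⊆
        insert (edgeLabel ident side L e)
          ((G.lineGraph.neighborSet e).toFinset.image (edgeLabel ident side L)) := by
      intro x hx
      rw [← Finset.filter_or] at hx
      obtain ⟨hx1, hx2⟩ := Finset.mem_filter.1 hx
      obtain ⟨f, rfl⟩ := (mem_allEdges port ident side L).1 hx1
      by_cases hef : e = f
      · exact Finset.mem_insert.2 (Or.inl (by rw [hef]))
      · refine Finset.mem_insert_of_mem (Finset.mem_image_of_mem _ ?_)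
        rw [Set.mem_toFinset]
        exact (lineGraph_adj_iff side L hid).2 ⟨hef, hx2⟩
    refine (Finset.card_le_card hsub).trans ((Finset.card_insert_le _ _).trans ?_)
    rw [edgeDegree, Set.ncard_eq_toFinset_card']
    exact Nat.succ_le_succ Finset.card_image_le
  have h2 : (((allEdges port ident side L).filter
        fun f => f.left = (edgeLabel ident side L e).left) ∩
      ((allEdges port ident side L).filter
        fun f => f.right = (edgeLabel ident side L e).right)).card ≤ 1 := by
    have key : ∀ x ∈ (((allEdges port ident side L).filter
        fun f => f.left = (edgeLabel ident side L e).left) ∩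
      ((allEdges port ident side L).filter
        fun f => f.right = (edgeLabel ident side L e).right)), x = edgeLabel ident side L e := by
      intro x hx
      rw [← Finset.filter_and] at hx
      obtain ⟨hx1, hx2, hx3⟩ := Finset.mem_filter.1 hx
      obtain ⟨f, rfl⟩ := (mem_allEdges port ident side L).1 hx1
      rw [eq_of_ends side L hid hx2 hx3]
    exact Finset.card_le_one.2 fun x hx y hy => (key x hx).trans (key y hy).symm
  omega

include hid in
theorem nodeDeg_le_maxDegree (b : Bool) (x : LEdge) :
    nodeDeg (allEdges port ident side L) (fun _ => 0) b x ≤ G.maxDegree := by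
  unfold nodeDeg
  simp only [exists_node_eq, node_zero_eq]
  set S := (allEdges port ident side L).filter fun f =>
    (if b then f.left else f.right) = if b then x.left else x.right with hS
  rcases S.eq_empty_or_nonempty with h | ⟨y, hy⟩
  · simp [h]
  have hy' := (Finset.mem_filter.1 hy).2
  obtain ⟨e, rfl⟩ := (mem_allEdges port ident side L).1 (Finset.mem_filter.1 hy).1
  set v := if b then trueEnd side e else falseEnd side e with hv
  have hsub : S ⊆ Finset.univ.image (portLabel port ident side L v) := by
    intro z hz
    have hz' := (Finset.mem_filter.1 hz).2.trans hy'.symm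
    obtain ⟨f, rfl⟩ := (mem_allEdges port ident side L).1 (Finset.mem_filter.1 hz).1
    have hvf : v ∈ f.1 := by
      rw [mem_edge_iff side]
      cases b
      · exact Or.inr (hid hz').symm
      · exact Or.inl (hid hz').symm
    obtain ⟨i, hi⟩ := exists_portEdge_eq port hvf
    exact Finset.mem_image.2 ⟨i, Finset.mem_univ _, by rw [portLabel_eq, hi]⟩
  refine (Finset.card_le_card hsub).trans (Finset.card_image_le.trans ?_)
  simpa using G.degree_le_maxDegree v

end Labels

/-! ### Correctness on the given instances -/

theorem six_lt_exp_two : (6 : ℝ) < Real.exp 2 := by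
  have h1 : Real.exp 2 = Real.exp 1 * Real.exp 1 := by rw [← Real.exp_add]; norm_num
  have h2 := Real.exp_one_gt_d9
  rw [h1]
  nlinarith

section Instance

variable {V : Type} [Fintype V] [DecidableEq V] {G : SimpleGraph V} [DecidableRel G.Adj]
  {L : G.edgeSet → Finset ℕ} {Δbar C Δ : ℕ} {S : ℝ}

theorem six_mul_edgeDegree_le (hS : Real.exp 2 ≤ S) (h : InFamily G L Δbar S C) (e : G.edgeSet) :
    6 * edgeDegree G e ≤ (L e).card ∧ 0 < (L e).card := by
  have h1 := h.slack e
  have h2 := six_lt_exp_two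
  have h3 : (0 : ℝ) ≤ edgeDegree G e := Nat.cast_nonneg _
  constructor
  · have : (6 : ℝ) * edgeDegree G e ≤ (L e).card := by nlinarith
    exact_mod_cast this
  · have : (0 : ℝ) < (L e).card := by nlinarith
    exact_mod_cast this

theorem admissible (port : PortNumbering G) {ident : V → ℕ} (side : G.Coloring Bool)
    (hid : Function.Injective ident) {ℓ J : ℕ} (hℓ : 0 < ℓ) (hC : C < 2 ^ ℓ)
    (hS : Real.exp 2 ≤ S) (h : InFamily G L Δbar S C) (hJ : G.maxDegree ≤ 2 ^ J) :
    Admissible ℓ J (allEdges port ident side L) := by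
  refine ⟨?_, ?_, ?_, fun b x => (nodeDeg_le_maxDegree port side L hid b x).trans hJ⟩
  · intro x hx c hc
    obtain ⟨e, rfl⟩ := (mem_allEdges port ident side L).1 hx
    have := Finset.mem_Icc.1 (h.lists_subset e hc)
    omega
  · intro x hx
    obtain ⟨e, rfl⟩ := (mem_allEdges port ident side L).1 hx
    have h1 := nodeDeg_add_le port side L hid e
    have h2 := six_mul_edgeDegree_le hS h e
    change _ ≤ (L e).card + 1
    omega
  · intro x hx hthr
    obtain ⟨e, rfl⟩ := (mem_allEdges port ident side L).1 hx
    have h1 := nodeDeg_add_le port side L hid e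
    have h2 := six_mul_edgeDegree_le hS h e
    have h3 : (threshold ℓ J * slackAt ℓ 0 : ℝ) ≤ (L e).card := hthr
    -- A list above the threshold has at least 4 colors; with 6 times the edge degree also bounded
    -- by the list size, this yields slack 2 even for the edge degree plus 2.
    have h4 : 2 ≤ threshold ℓ J := by
      have : 0 < ℓ * gameSteps ℓ J := by unfold gameSteps phases; positivity
      unfold threshold
      nlinarith
    have h5 : threshold ℓ J * 2 ≤ (L e).card := by
      simp only [slackAt, pow_zero, div_one] at h3
      exact_mod_cast h3
    have h6 : 2 * (nodeDeg (allEdges port ident side L) (fun _ => 0) true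
        (edgeLabel ident side L e) + nodeDeg (allEdges port ident side L) (fun _ => 0) false
          (edgeLabel ident side L e)) ≤ (L e).card := by omega
    exact_mod_cast h6

theorem isSolution_gather (port : PortNumbering G) {ident : V → ℕ} (side : G.Coloring Bool)
    (hid : Function.Injective ident) {ℓ J : ℕ} (hℓ : 0 < ℓ) (hC : C < 2 ^ ℓ)
    (hS : Real.exp 2 ≤ S) (h : InFamily G L Δbar S C) (hJ : G.maxDegree ≤ 2 ^ J) :
    IsSolution port L ((gather (finalColor ℓ J)).result G port (nodeInput port ident side L)
      (localityRadius ℓ J + 1)) := by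
  have hE := admissible port side hid hℓ hC hS h hJ
  have hmem : ∀ e, edgeLabel ident side L e ∈ allEdges port ident side L := fun e =>
    (mem_allEdges port ident side L).2 ⟨e, rfl⟩
  refine ⟨SimpleGraph.Coloring.mk (fun e =>
    finalColor ℓ J (allEdges port ident side L) (edgeLabel ident side L e)) ?_, ?_, ?_⟩
  · intro e f hadj
    obtain ⟨hne, hadj⟩ := (lineGraph_adj_iff side L hid).1 hadj
    refine finalColor_ne hℓ hE (hmem e) (hmem f) (fun heq => hne ?_) hadj
    exact eq_of_ends side L hid (congrArg LEdge.left heq) (congrArg LEdge.right heq)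
  · exact fun e => finalColor_mem hℓ hE (hmem e)
  · intro v i
    rw [gather_result port ident side L _ hid (finalColor_local hℓ), portLabel_eq]
    rfl

/-- Without communication, every edge is colored with the smallest color of its list. -/
noncomputable def minColor : Algorithm NodeInput NodeOutput where
  State := NodeInput
  Msg := Unit
  init _ x := x
  send _ _ _ := ()
  receive _ s _ := s
  output _ s i := sInf (s.list i : Set ℕ)

/-- In the degenerate cases the round bound is zero, but no two edges are adjacent: if Δ ≤ 1
trivially, and if C ≤ 1 because an edge of positive degree needs at least 6 colors. -/
theorem isSolution_minColor (port : PortNumbering G) (ident : V → ℕ) (side : G.Coloring Bool)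
    (hS : Real.exp 2 ≤ S) (h : InFamily G L Δbar S C) (hΔ : G.maxDegree ≤ Δ)
    (hsmall : ¬ (2 ≤ C ∧ 2 ≤ Δ)) :
    IsSolution port L (minColor.result G port (nodeInput port ident side L) 0) := by
  refine ⟨SimpleGraph.Coloring.mk (fun e => sInf (L e : Set ℕ)) ?_, fun e => ?_, fun v i => rfl⟩
  · intro e f hadj
    exfalso
    by_cases hC : 2 ≤ C
    · have hdeg : G.maxDegree ≤ 1 := by omega
      obtain ⟨hne, v, hv, hv'⟩ := SimpleGraph.lineGraph_adj_iff_exists.1 hadj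
      obtain ⟨i, hi⟩ := exists_portEdge_eq port hv
      obtain ⟨j, hj⟩ := exists_portEdge_eq port hv'
      have hi' := i.2
      have hj' := j.2
      have hv1 := (G.degree_le_maxDegree v).trans hdeg
      have hij : i = j := Fin.ext (by omega)
      exact hne (by rw [← hi, ← hj, hij])
    · have h1 := (six_mul_edgeDegree_le hS h e).1
      have h2 : 0 < edgeDegree G e := (Set.ncard_pos (Set.toFinite _)).2 ⟨f, hadj⟩
      have h3 := Finset.card_le_card (h.lists_subset e)
      rw [Nat.card_Icc] at h3
      omega
  · exact Nat.sInf_mem (Finset.card_pos.1 (six_mul_edgeDegree_le hS h e).2)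

end Instance

/-! ### The number of rounds -/

/-- Orders of magnitude with `j = J + 1`: `phases` is ℓ, `capDivisor` is ℓ²j, `gameSteps` is ℓ⁵j²,
and a level, with `j * phases` orientation phases, is ℓ⁶j³. There are ℓ levels; the greedy part is
smaller by a factor j. -/
theorem localityRadius_le : ∃ K : ℕ, ∀ ℓ J : ℕ, 0 < ℓ →
    localityRadius ℓ J + 1 ≤ K * (ℓ ^ 7 * (J + 1) ^ 3) := by
  refine ⟨3 + (2 + 65 * (3 * (65 * 8321 ^ 2) + 3)) + 128 * (65 * 8321 ^ 2), fun ℓ J hℓ => ?_⟩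
  set j := J + 1 with hj
  have hj0 : 0 < j := Nat.succ_pos _
  have h1 : ∀ a b, 1 ≤ ℓ ^ a * j ^ b := fun a b => Nat.succ_le_of_lt (by positivity)
  -- Below, 8321 is 128 · 65 + 1.
  have hP : phases ℓ ≤ 65 * ℓ := by unfold phases; omega
  have hm : capDivisor ℓ J + 1 ≤ 8321 * (ℓ ^ 2 * j ^ 1) := by
    calc capDivisor ℓ J + 1 ≤ 128 * ℓ * (65 * ℓ) * j + ℓ ^ 2 * j ^ 1 := by
          unfold capDivisor; gcongr; exact h1 2 1
      _ = _ := by ring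
  have hT : gameSteps ℓ J ≤ 65 * 8321 ^ 2 * (ℓ ^ 5 * j ^ 2) := by
    calc gameSteps ℓ J ≤ 65 * ℓ * (8321 * (ℓ ^ 2 * j ^ 1)) ^ 2 := by unfold gameSteps; gcongr
      _ = _ := by ring
  generalize 65 * 8321 ^ 2 = a at hT ⊢
  have hR : phaseRounds ℓ J ≤ (3 * a + 3) * (ℓ ^ 5 * j ^ 2) := by
    have := h1 5 2
    unfold phaseRounds
    rw [add_mul]
    linarith
  have hl : levelRounds ℓ J ≤ (2 + 65 * (3 * a + 3)) * (ℓ ^ 6 * j ^ 3) := by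
    calc levelRounds ℓ J ≤ 2 * (ℓ ^ 6 * j ^ 3) +
          j * (65 * ℓ) * ((3 * a + 3) * (ℓ ^ 5 * j ^ 2)) := by
          unfold levelRounds; gcongr; have := h1 6 3; omega
      _ = _ := by ring
  have hb : rankBound ℓ J ≤ 64 * a * (ℓ ^ 6 * j ^ 3) := by
    calc rankBound ℓ J ≤ 2 * (32 * ℓ * (a * (ℓ ^ 5 * j ^ 2))) := by
          unfold rankBound threshold; gcongr
      _ = 64 * a * (ℓ ^ 6 * j ^ 2) := by ring
      _ ≤ _ := by gcongr; omega
  calc localityRadius ℓ J + 1 = 3 + ℓ * levelRounds ℓ J + 2 * (ℓ * rankBound ℓ J) := by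
        unfold localityRadius; ring
    _ ≤ 3 * (ℓ ^ 7 * j ^ 3) + ℓ * ((2 + 65 * (3 * a + 3)) * (ℓ ^ 6 * j ^ 3)) +
        2 * (ℓ * (64 * a * (ℓ ^ 6 * j ^ 3))) := by
        gcongr; have := h1 7 3; omega
    _ = _ := by ring

theorem logb_two_nonneg (n : ℕ) : 0 ≤ Real.logb 2 n := by
  rcases Nat.eq_zero_or_pos n with rfl | h
  · simp
  · exact Real.logb_nonneg one_lt_two (by exact_mod_cast h)

theorem one_le_logb_two {n : ℕ} (h : 2 ≤ n) : 1 ≤ Real.logb 2 n := by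
  rw [Real.le_logb_iff_rpow_le one_lt_two (by positivity), Real.rpow_one]
  exact_mod_cast h

theorem natLog_two_le (n : ℕ) : (Nat.log 2 n : ℝ) ≤ Real.logb 2 n := Real.natLog_le_logb n 2

end DistributedColoring

/-! ### Assembly of the algorithm and its round bound -/

theorem mainTheorem7 :
    ∃ (K : ℝ) (A : (n Δ C : ℕ) →
        LocalModel.Algorithm ListEdgeColoring.NodeInput ListEdgeColoring.NodeOutput)
      (T : (n Δ C : ℕ) → ℕ),
      (∀ n Δ C : ℕ, (T n Δ C : ℝ) ≤ K * Real.logb 2 (C : ℝ) ^ 7 * Real.logb 2 (Δ : ℝ) ^ 4) ∧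
      ∀ (Δbar : ℕ) (S : ℝ) (C Δ : ℕ), Real.exp 2 ≤ S →
        ∀ (V : Type) [Fintype V] [DecidableEq V] (G : SimpleGraph V) [DecidableRel G.Adj]
          (L : G.edgeSet → Finset ℕ) (side : G.Coloring Bool)
          (ident : V → ℕ) (port : LocalModel.PortNumbering G),
          ListEdgeColoring.InFamily G L Δbar S C → G.maxDegree ≤ Δ → Function.Injective ident →
          ListEdgeColoring.IsSolution port L
            ((A (Fintype.card V) Δ C).result G port
              (ListEdgeColoring.nodeInput port ident side L) (T (Fintype.card V) Δ C)) := by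
  obtain ⟨K, hK⟩ := DistributedColoring.localityRadius_le
  -- The factors come from `log C + 1 ≤ 2 log C` and `log Δ + 2 ≤ 3 log Δ`, valid once both
  -- logarithms are at least 1.
  refine ⟨K * (2 ^ 7 * 3 ^ 3),
    fun _ Δ C => if 2 ≤ C ∧ 2 ≤ Δ then DistributedColoring.gather (DistributedColoring.finalColor (Nat.log 2 C + 1) (Nat.log 2 Δ + 1))
      else DistributedColoring.minColor,
    fun _ Δ C => if 2 ≤ C ∧ 2 ≤ Δ then DistributedColoring.localityRadius (Nat.log 2 C + 1) (Nat.log 2 Δ + 1) + 1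
      else 0, fun n Δ C => ?_, ?_⟩
  · have hC := DistributedColoring.logb_two_nonneg C
    have hΔ := DistributedColoring.logb_two_nonneg Δ
    dsimp only
    split_ifs with h
    · have h1 := DistributedColoring.one_le_logb_two h.1
      have h2 := DistributedColoring.one_le_logb_two h.2
      have h3 := DistributedColoring.natLog_two_le C
      have h4 := DistributedColoring.natLog_two_le Δ
      have h5 : ((DistributedColoring.localityRadius (Nat.log 2 C + 1) (Nat.log 2 Δ + 1) + 1 : ℕ) : ℝ) ≤
          K * (((Nat.log 2 C : ℝ) + 1) ^ 7 * ((Nat.log 2 Δ : ℝ) + 1 + 1) ^ 3) := by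
        exact_mod_cast hK (Nat.log 2 C + 1) (Nat.log 2 Δ + 1) (Nat.succ_pos _)
      calc ((DistributedColoring.localityRadius (Nat.log 2 C + 1) (Nat.log 2 Δ + 1) + 1 : ℕ) : ℝ)
          ≤ K * (((Nat.log 2 C : ℝ) + 1) ^ 7 * ((Nat.log 2 Δ : ℝ) + 1 + 1) ^ 3) := h5
        _ ≤ K * ((2 * Real.logb 2 C) ^ 7 * (3 * Real.logb 2 Δ) ^ 3) := by
            gcongr <;> linarith
        _ = K * (2 ^ 7 * 3 ^ 3) * Real.logb 2 C ^ 7 * Real.logb 2 Δ ^ 3 := by ring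
        -- The construction needs only the third power of `log Δ`; the fourth is larger because `log
        -- Δ ≥ 1`.
        _ ≤ K * (2 ^ 7 * 3 ^ 3) * Real.logb 2 C ^ 7 * Real.logb 2 Δ ^ 4 := by
            gcongr
            norm_num
    · rw [Nat.cast_zero]
      positivity
  · intro Δbar S C Δ hS V _ _ G _ L side ident port h hΔ hid
    dsimp only
    split_ifs with hlarge
    · refine DistributedColoring.isSolution_gather port side hid (Nat.succ_pos _)
        (Nat.lt_pow_succ_log_self one_lt_two C) hS h (hΔ.trans ?_)
      exact (Nat.lt_pow_succ_log_self one_lt_two Δ).le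
    · exact DistributedColoring.isSolution_minColor port ident side hS h hΔ hlarge
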